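/- **Theorem 5.3.** *Setting.* Let $\mathsf M$ be a wide-sense stationary random $L^2$ signed measure on $\mathbb R^d$: a family of real square-integrable random variables $I_{\mathsf M}(f)=\int f\,d\mathsf M$, indexed by the bounded measurable compactly supported $f:\mathbb R^d\to\mathbb R$, a.s. linear and $\sigma$-additive in $f$, with $\mathrm{Var}(I_{\mathsf M}(f(\cdot-x)))=\mathrm{Var}(I_{\mathsf M}(f))$ for all $x$; $I_{\mathsf M}$ is extended to complex $f$ by complex linearity, and $\mathrm{Var}(X)=\mathbf E|X-\mathbf EX|^2$. Write $\hat f(u)=\int e^{-i\langle u,t\rangle}f(t)\,dt$. Let $\mathsf S$ be the spectral measure of $\mathsf M$, that is, the even non-negative locally finite measure on $\mathbb R^d$ with $\mathrm{Var}(I_{\mathsf M}(f))=\int|\hat f|^2\,d\mathsf S$ for all such $f:\mathbb R^d\to\mathbb R$, and let $\mathsf s$ be the density of its absolutely continuous part with respect to Lebesgue measure. Put $L^2(\mathsf s^{-1})=\{\psi:\int|\psi|^2\mathsf s^{-1}<\infty\}$, with the conventions $1/0=\infty$ and $0\cdot\infty=0$. Let $A\subset\mathbb R^d$ be a convex body (a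 compact convex set with non-empty interior). Let $\mathcal C_c^\infty(A^c)$ be the space of smooth functions $h:\mathbb R^d\to\mathbb C$ whose compact support is contained in $A^c$, and let $\mathcal E(A)$ be the class of restrictions $\psi$ to $\mathbb R^d$ of entire functions of exponential type on $\mathbb C^d$ that have at most polynomial growth on $\mathbb R^d$ and spectrum in $A$, i.e. whose Fourier transform $\hat\psi$, as a tempered distribution ($\langle\varphi,\hat\psi\rangle=\int\hat\varphi\,\psi$), is supported in $A$. For $\gamma:\mathbb R^d\to\mathbb C$ bounded, measurable and compactly supported, $\mathsf M$ is called linearly $\gamma$-rigid on $A$ if $$\inf_{h\in\mathcal C_c^\infty(A^c)}\mathrm{Var}\Big(\int_A\gamma\,d\mathsf M-\int h\,d\mathsf M\Big)=0 .$$ *Conclusion.* 1. For every $\psi\in\mathcal E(A)\cap L^2(\mathsf s^{-1})$ the distribution $\hat\psi$ is a function in $L^2(\mathbb R^d)$ (so that the integral in 2 makes sense). 2. For every bounded measurable compactly supported $\gamma:\mathbb R^d\to\mathbb C$, $\mathsf M$ is linearly $\gamma$-rigid on $A$ if and only if $\int_A\bar\gamma\,\hat\psi\,dt=0$ for every $\psi\in\mathcal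 E(A)\cap L^2(\mathsf s^{-1})$. 3. The orthogonal complement $H_A^\perp=\{\varphi\in L^2(\mathsf S):\int\bar\varphi\,\hat h\,d\mathsf S=0\text{ for all }h\in\mathcal C_c^\infty(A^c)\}$ equals $\{\bar\psi\,\mathsf s^{-1}:\psi\in\mathcal E(A)\cap L^2(\mathsf s^{-1})\}$, where $\bar\psi\,\mathsf s^{-1}$ is understood as an element of $L^2(\mathsf S)$ that vanishes on the singular part of $\mathsf S$. -/

import Mathlib

open MeasureTheory ProbabilityTheory
open scoped ComplexConjugate

noncomputable section

/-- `f` is measurable, bounded and compactly supported. -/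
def IsBddCompact {d : ℕ} {F : Type*} [NormedAddCommGroup F] [MeasurableSpace F]
    (f : EuclideanSpace ℝ (Fin d) → F) : Prop :=
  Measurable f ∧ (∃ C : ℝ, ∀ x, ‖f x‖ ≤ C) ∧ HasCompactSupport f

/-- A wide-sense stationary square-integrable random signed measure on `ℝ^d`: a family of real
square-integrable random variables `M.integral f` (read: `∫ f dM`), indexed by bounded measurable
compactly supported `f`, almost surely linear and countably additive, with
translation-invariant variance. -/
structure StatRandomMeasure {Ω : Type*} [MeasurableSpace Ω] (P : Measure Ω) (d : ℕ) where
  /-- The linear statistic `∫ f dM`; its values on functions `f` that are not bounded, measurable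
  and compactly supported are irrelevant. -/
  integral : (EuclideanSpace ℝ (Fin d) → ℝ) → Ω → ℝ
  memLp : ∀ f, IsBddCompact f → MemLp (integral f) 2 P
  linear : ∀ (a : ℝ) (f g : EuclideanSpace ℝ (Fin d) → ℝ), IsBddCompact f → IsBddCompact g →
    ∀ᵐ ω ∂P, integral (fun x => a * f x + g x) ω = a * integral f ω + integral g ω
  sigma_additive : ∀ (f : EuclideanSpace ℝ (Fin d) → ℝ) (B : ℕ → Set (EuclideanSpace ℝ (Fin d))),
    IsBddCompact f → (∀ n, MeasurableSet (B n)) → Pairwise (fun m n => Disjoint (B m) (B n)) →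
    ∀ᵐ ω ∂P, Filter.Tendsto (fun n => ∑ i ∈ Finset.range n, integral ((B i).indicator f) ω)
      Filter.atTop (nhds (integral ((⋃ n, B n).indicator f) ω))
  stationary : ∀ (x : EuclideanSpace ℝ (Fin d)) (f : EuclideanSpace ℝ (Fin d) → ℝ),
    IsBddCompact f → Var[integral (fun y => f (y - x)); P] = Var[integral f; P]

/-- The Fourier transform `f̂(u) = ∫ e^{-i⟨u,t⟩} f(t) dt` of an integrable function. -/
def fourierHat {d : ℕ} (f : EuclideanSpace ℝ (Fin d) → ℂ) (u : EuclideanSpace ℝ (Fin d)) : ℂ :=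
  ∫ t, Complex.exp (-(Complex.I * ((inner ℝ u t : ℝ) : ℂ))) * f t

/-- `S` is the spectral measure of `M`: the even (locally finite, nonnegative) measure such that
`Var(∫ f dM) = ∫ |f̂|² dS` for every bounded measurable compactly supported real `f`. -/
structure IsSpectralMeasure {Ω : Type*} [MeasurableSpace Ω] {P : Measure Ω} {d : ℕ}
    (M : StatRandomMeasure P d) (S : Measure (EuclideanSpace ℝ (Fin d))) : Prop where
  locallyFinite : IsLocallyFiniteMeasure S
  even : S.map (fun u => -u) = S
  variance_eq : ∀ f : EuclideanSpace ℝ (Fin d) → ℝ, IsBddCompact f →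
    ∫⁻ u, ‖fourierHat (fun t => (f t : ℂ)) u‖ₑ ^ 2 ∂S = ENNReal.ofReal (Var[M.integral f; P])

/-- The spectral density: the density of the absolutely continuous part of `S`. -/
def spectralDensity {d : ℕ} (S : Measure (EuclideanSpace ℝ (Fin d))) :
    EuclideanSpace ℝ (Fin d) → ENNReal :=
  S.rnDeriv volume

/-- The linear statistic `∫ f dM` of a complex-valued function `f`. -/
def StatRandomMeasure.cintegral {Ω : Type*} [MeasurableSpace Ω] {P : Measure Ω} {d : ℕ}
    (M : StatRandomMeasure P d) (f : EuclideanSpace ℝ (Fin d) → ℂ) (ω : Ω) : ℂ :=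
  (M.integral (fun x => (f x).re) ω : ℂ) + Complex.I * (M.integral (fun x => (f x).im) ω : ℂ)

/-- The variance `E|X - E X|²` of a complex random variable. -/
def complexVariance {Ω : Type*} [MeasurableSpace Ω] (P : Measure Ω) (X : Ω → ℂ) : ℝ :=
  ∫ ω, ‖X ω - ∫ ω', X ω' ∂P‖ ^ 2 ∂P

/-- The space `C_c^∞(U)` of smooth complex functions with compact support contained in `U`. -/
def testFunctions {d : ℕ} (U : Set (EuclideanSpace ℝ (Fin d))) :
    Set (EuclideanSpace ℝ (Fin d) → ℂ) :=
  {h | ContDiff ℝ ((⊤ : ℕ∞) : WithTop ℕ∞) h ∧ HasCompactSupport h ∧ tsupport h ⊆ U}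

/-- `M` is linearly `γ`-rigid on `A`:
the infimum of `Var(∫_A γ dM - ∫ h dM)` over `h ∈ C_c^∞(Aᶜ)` is zero. -/
def LinearlyRigid {Ω : Type*} [MeasurableSpace Ω] {P : Measure Ω} {d : ℕ}
    (M : StatRandomMeasure P d) (γ : EuclideanSpace ℝ (Fin d) → ℂ)
    (A : Set (EuclideanSpace ℝ (Fin d))) : Prop :=
  ⨅ h : testFunctions Aᶜ,
    complexVariance P (fun ω => M.cintegral (A.indicator γ) ω - M.cintegral h.1 ω) = 0

/-- The inclusion of `ℝ^d` in `ℂ^d`. -/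
def toComplexSpace {d : ℕ} (u : EuclideanSpace ℝ (Fin d)) : EuclideanSpace ℂ (Fin d) :=
  WithLp.toLp 2 (fun i => (u i : ℂ))

/-- `ψ` is the restriction to `ℝ^d` of an entire function on `ℂ^d` of exponential type. -/
def IsEntireExpType {d : ℕ} (ψ : EuclideanSpace ℝ (Fin d) → ℂ) : Prop :=
  ∃ F : EuclideanSpace ℂ (Fin d) → ℂ, Differentiable ℂ F ∧
    (∃ C R : ℝ, ∀ z, ‖F z‖ ≤ C * Real.exp (R * ‖z‖)) ∧
    ∀ u, ψ u = F (toComplexSpace u)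

/-- The class `E(A)`: entire functions of exponential type, of polynomial growth on `ℝ^d` (so that
they are tempered distributions), whose spectrum is contained in the closed set `A`, that is,
whose distributional Fourier transform `φ ↦ ∫ φ̂ ψ` vanishes on all test functions `φ` supported
in the complement of `A`. -/
def expTypeClass {d : ℕ} (A : Set (EuclideanSpace ℝ (Fin d))) :
    Set (EuclideanSpace ℝ (Fin d) → ℂ) :=
  {ψ | IsEntireExpType ψ ∧ (∃ (C : ℝ) (N : ℕ), ∀ u, ‖ψ u‖ ≤ C * (1 + ‖u‖) ^ N) ∧
    ∀ φ ∈ testFunctions Aᶜ, ∫ u, fourierHat φ u * ψ u = 0}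

/-- The condition `∫ |ψ|² s⁻¹ < ∞`, with `1/0 = ∞` (and `0 · ∞ = 0`). -/
def SqIntegrableInv {d : ℕ} (s : EuclideanSpace ℝ (Fin d) → ENNReal)
    (ψ : EuclideanSpace ℝ (Fin d) → ℂ) : Prop :=
  ∫⁻ u, ‖ψ u‖ₑ ^ 2 * (s u)⁻¹ < ⊤

/-- The Fourier transform, in the sense of tempered distributions, of the function `ψ` of
polynomial growth is the square-integrable function `g`: `∫ φ g = ∫ φ̂ ψ` for every test
function `φ`. -/
def IsL2Fourier {d : ℕ} (ψ g : EuclideanSpace ℝ (Fin d) → ℂ) : Prop :=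
  MemLp g 2 volume ∧
    ∀ φ ∈ testFunctions (Set.univ : Set (EuclideanSpace ℝ (Fin d))),
      ∫ t, φ t * g t = ∫ u, fourierHat φ u * ψ u

/-- `φ` is orthogonal in `L²(S)` to every `ĥ` with `h ∈ C_c^∞(Aᶜ)`. -/
def IsOrthogonalOutside {d : ℕ} (S : Measure (EuclideanSpace ℝ (Fin d)))
    (A : Set (EuclideanSpace ℝ (Fin d))) (φ : EuclideanSpace ℝ (Fin d) → ℂ) : Prop :=
  ∀ h ∈ testFunctions Aᶜ, ∫ u, conj (φ u) * fourierHat h u ∂S = 0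

/-- In `L²(S)`, `φ` is the function `ρ s⁻¹`, where `s` is the spectral density: `φ = ρ / s` almost
everywhere for the absolutely continuous part `s(u) du` of `S`, and `φ = 0` almost everywhere for
the singular part of `S`. -/
def IsDivDensity {d : ℕ} (S : Measure (EuclideanSpace ℝ (Fin d)))
    (φ ρ : EuclideanSpace ℝ (Fin d) → ℂ) : Prop :=
  (∀ᵐ u ∂(volume.withDensity (spectralDensity S)),
    φ u = ρ u / ((spectralDensity S u).toReal : ℂ)) ∧
  ∀ᵐ u ∂(S.singularPart volume), φ u = 0

end

/-! The variance formula makes a complex statistic of `f` an element of `L²(S)`, namely `f̂`, so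
everything reduces to describing the `φ ∈ L²(S)` orthogonal to all `ĥ` with `h` supported off `A`.

Take a smooth product cutoff `χ(t) = ∏ κ(t_j)` equal to 1 near `A`. For any test function `h` the
difference `h - χh` is supported off `A`, so orthogonality lets `(χh)^` replace `ĥ` against `conj φ
dS`. Since `(χh)^` is a convolution of `ĥ` with `χ̂`, Fubini gives `∫ conj φ ĥ dS = ∫ ĥ ψ du` with
`ψ(u) = (2π)^{-d} ∫ χ̂(v - u) conj (φ v) dS(v)` (`entireDensity`). By Fourier uniqueness the complex
measures `conj φ dS` and `ψ du` coincide: `φ` vanishes on the singular part and `s conj φ = ψ`. As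
`χ̂` is entire of exponential type, so is `ψ`; its spectrum lies in `A` by the same identity. The
converse is a direct substitution.

The analytic input is that `S` is translation bounded: `∫ cauchyWeight (v - u) dS(v)` is bounded
uniformly in `u`. This follows from finiteness of variances through the closed graph theorem. It
makes the integral defining `ψ` converge, and a Schur-type estimate then puts `ψ` in `L²(du)`, with
no boundedness assumed on `s`. Rigidity is finally the statement that a vector lies in the closure
of a subspace, tested on the orthogonal complement and rewritten by Plancherel. -/

noncomputable section

/-! ### Holomorphic parameter integrals and Fourier–Laplace transforms on the line -/

/-- Domination of `f` alone suffices: Cauchy's estimate on unit balls inside the ball of radius 2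
turns it into domination of the derivative on the ball of radius 1, so differentiation under the
integral applies. -/
theorem differentiable_integral_mul_of_dominated {E V : Type*} [NormedAddCommGroup E]
    [NormedSpace ℂ E] [FiniteDimensional ℂ E] [TopologicalSpace V] [MeasurableSpace V]
    [BorelSpace V] [SecondCountableTopology V] {μ : Measure V} {f : E → V → ℂ} {c : V → ℂ}
    (hf : Continuous (Function.uncurry f)) (hd : ∀ v, Differentiable ℂ fun z => f z v)
    (hc : AEStronglyMeasurable c μ)
    (hb : ∀ z₀ : E, ∃ g : V → ℝ, Integrable (fun v => g v * ‖c v‖) μ ∧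
      ∀ z ∈ Metric.ball z₀ 2, ∀ v, ‖f z v‖ ≤ g v) :
    Differentiable ℂ fun z => ∫ v, f z v * c v ∂μ := by
  intro z₀
  obtain ⟨g, hg, hfg⟩ := hb z₀
  have hmeas : ∀ z, AEStronglyMeasurable (fun v => f z v * c v) μ := fun z =>
    (Continuous.aestronglyMeasurable (by fun_prop)).mul hc
  have hfd : ∀ v, ∀ z ∈ Metric.ball z₀ 1, ‖fderiv ℂ (fun z => f z v) z‖ ≤ 2 * g v := by
    intro v z hz
    have hsub : Metric.ball z 1 ⊆ Metric.ball z₀ 2 := by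
      apply Metric.ball_subset_ball'
      have := Metric.mem_ball.1 hz
      linarith
    have := Complex.norm_fderiv_le_div_of_mapsTo_ball (f := fun z => f z v) (c := z) (R₁ := 1)
      (R₂ := 2 * g v) (hd v).differentiableOn ?_ one_pos
    · simpa using this
    · intro y hy
      rw [Metric.mem_closedBall, dist_eq_norm]
      have h1 := hfg y (hsub hy) v
      have h2 := hfg z (hsub (Metric.mem_ball_self one_pos)) v
      linarith [norm_sub_le (f y v) (f z v)]
  have : LocallyCompactSpace E := by
    have := FiniteDimensional.proper ℂ E
    infer_instance
  have hm' : Measurable fun v => fderiv ℂ (fun z => f z v) z₀ := by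
    borelize E
    have hc' : Continuous (Function.uncurry fun v z => f z v) := by
      exact hf.comp continuous_swap
    exact (measurable_fderiv_with_param ℂ hc').comp (measurable_id.prodMk measurable_const)
  have key := hasFDerivAt_integral_of_dominated_loc_of_lip (μ := μ) (𝕜 := ℂ)
    (F := fun z v => f z v * c v) (x₀ := z₀) (s := Metric.ball z₀ 1)
    (bound := fun v => 2 * (g v * ‖c v‖))
    (F' := fun v => c v • fderiv ℂ (fun z => f z v) z₀)
    (Metric.ball_mem_nhds _ one_pos) (Filter.Eventually.of_forall hmeas) ?_ ?_ ?_
    (hg.const_mul 2) ?_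
  · exact key.2.differentiableAt
  · refine hg.mono' (hmeas z₀) (Filter.Eventually.of_forall fun v => ?_)
    rw [norm_mul]
    exact mul_le_mul_of_nonneg_right (hfg z₀ (Metric.mem_ball_self two_pos) v) (norm_nonneg _)
  · exact hc.smul hm'.aestronglyMeasurable
  · refine Filter.Eventually.of_forall fun v => ?_
    refine (convex_ball z₀ 1).lipschitzOnWith_of_nnnorm_fderiv_le (𝕜 := ℂ)
      (fun z _ => ((hd v) z).mul_const _) fun z hz => ?_
    rw [← NNReal.coe_le_coe, coe_nnnorm, Real.coe_nnabs, fderiv_mul_const ((hd v) z), norm_smul]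
    have h0 : 0 ≤ g v := (norm_nonneg _).trans (hfg z₀ (Metric.mem_ball_self two_pos) v)
    rw [abs_of_nonneg (by positivity)]
    nlinarith [hfd v z hz, norm_nonneg (c v)]
  · refine Filter.Eventually.of_forall fun v => ?_
    exact ((hd v) z₀).hasFDerivAt.mul_const _

/-- The Fourier–Laplace transform of a function on the line. -/
def fourierLaplace (κ : ℝ → ℂ) (ζ : ℂ) : ℂ :=
  ∫ t : ℝ, Complex.exp (-(Complex.I * (ζ * t))) * κ t

theorem norm_exp_neg_I_mul (ζ : ℂ) (t : ℝ) :
    ‖Complex.exp (-(Complex.I * (ζ * t)))‖ = Real.exp (ζ.im * t) := by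
  rw [Complex.norm_exp]
  simp

theorem exists_norm_fourierLaplace_le {κ : ℝ → ℂ} (hκ : Continuous κ) (hs : HasCompactSupport κ) :
    ∃ C R : ℝ, 0 ≤ R ∧ ∀ ζ, ‖fourierLaplace κ ζ‖ ≤ C * Real.exp (R * |ζ.im|) := by
  obtain ⟨R, hR⟩ := hs.isCompact.isBounded.exists_norm_le
  refine ⟨∫ t, ‖κ t‖, |R|, abs_nonneg _, fun ζ => ?_⟩
  rw [mul_comm, ← integral_const_mul]
  refine norm_integral_le_of_norm_le
    ((hκ.integrable_of_hasCompactSupport hs).norm.const_mul _)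
    (Filter.Eventually.of_forall fun t => ?_)
  rw [norm_mul, norm_exp_neg_I_mul]
  by_cases ht : t ∈ tsupport κ
  · refine mul_le_mul_of_nonneg_right (Real.exp_le_exp.2 ?_) (norm_nonneg _)
    calc ζ.im * t ≤ |ζ.im * t| := le_abs_self _
      _ = |t| * |ζ.im| := by rw [abs_mul, mul_comm]
      _ ≤ |R| * |ζ.im| := by
        exact mul_le_mul_of_nonneg_right ((hR t ht).trans (le_abs_self _)) (abs_nonneg _)
  · simp [image_eq_zero_of_notMem_tsupport ht]

theorem differentiable_fourierLaplace {κ : ℝ → ℂ} (hκ : Continuous κ)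
    (hs : HasCompactSupport κ) : Differentiable ℂ (fourierLaplace κ) := by
  refine differentiable_integral_mul_of_dominated (by fun_prop) (fun v => by fun_prop)
    hκ.aestronglyMeasurable fun z₀ => ⟨fun t => Real.exp ((|z₀.im| + 2) * |t|), ?_, ?_⟩
  · refine Continuous.integrable_of_hasCompactSupport (by fun_prop) ?_
    exact hs.norm.mul_left
  · intro z hz t
    rw [norm_exp_neg_I_mul]
    refine Real.exp_le_exp.2 ((le_abs_self _).trans ?_)
    rw [abs_mul]
    gcongr
    have h1 : |(z - z₀).im| ≤ ‖z - z₀‖ := Complex.abs_im_le_norm _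
    rw [Metric.mem_ball, dist_eq_norm] at hz
    rw [Complex.sub_im] at h1
    have := abs_sub_abs_le_abs_sub z.im z₀.im
    linarith

theorem fourierLaplace_deriv {κ : ℝ → ℂ} (hκ : ContDiff ℝ 1 κ) (hs : HasCompactSupport κ) (ζ : ℂ) :
    fourierLaplace (deriv κ) ζ = Complex.I * ζ * fourierLaplace κ ζ := by
  have hκ' : Continuous (deriv κ) := hκ.continuous_deriv le_rfl
  have h := integral_mul_deriv_eq_deriv_mul_of_integrable
    (u := fun t : ℝ => Complex.exp (-(Complex.I * (ζ * t))))
    (u' := fun t : ℝ => Complex.exp (-(Complex.I * (ζ * t))) * (-(Complex.I * ζ)))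
    (v := κ) (v' := deriv κ) ?_ ?_ ?_ ?_ ?_
  · unfold fourierLaplace
    rw [h, ← integral_neg, ← integral_const_mul]
    congr 1
    ext t
    ring
  · intro t _
    have : HasDerivAt (fun t : ℝ => -(Complex.I * (ζ * t))) (-(Complex.I * ζ)) t := by
      have := (((hasDerivAt_id (t : ℂ)).const_mul ζ).const_mul Complex.I).neg.comp_ofReal
      simpa using this
    exact this.cexp
  · intro t _
    exact (hκ.differentiable one_ne_zero t).hasDerivAt
  · exact Continuous.integrable_of_hasCompactSupport (by fun_prop) hs.deriv.mul_left
  · exact Continuous.integrable_of_hasCompactSupport (by fun_prop) hs.mul_left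
  · exact Continuous.integrable_of_hasCompactSupport (by fun_prop) hs.mul_left

/-- Two integrations by parts give the transform of `κ''` as `-ζ²` times that of `κ`. Adding the
crude exponential bounds for both transforms, and using `ζ.re ^ 2 ≤ ‖ζ‖ ^ 2`, yields the decay. -/
theorem exists_norm_fourierLaplace_le_inv {κ : ℝ → ℂ} (hκ : ContDiff ℝ 2 κ)
    (hs : HasCompactSupport κ) :
    ∃ C R : ℝ, 0 ≤ C ∧ 0 ≤ R ∧ ∀ ζ,
      ‖fourierLaplace κ ζ‖ ≤ C * Real.exp (R * |ζ.im|) * (1 + ζ.re ^ 2)⁻¹ := by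
  have hd1 : ContDiff ℝ 1 (deriv κ) := by
    have := hκ.iterate_deriv' 1 1
    simpa using this
  obtain ⟨C₁, R₁, hR₁, h₁⟩ := exists_norm_fourierLaplace_le hκ.continuous hs
  obtain ⟨C₂, R₂, hR₂, h₂⟩ := exists_norm_fourierLaplace_le
    (hd1.continuous_deriv le_rfl) hs.deriv.deriv
  refine ⟨|C₁| + |C₂|, R₁ + R₂, by positivity, by positivity, fun ζ => ?_⟩
  have h2 : fourierLaplace (deriv (deriv κ)) ζ = -(ζ ^ 2) * fourierLaplace κ ζ := by
    rw [fourierLaplace_deriv hd1 hs.deriv,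
      fourierLaplace_deriv (hκ.of_le (by norm_num)) hs]
    linear_combination ζ ^ 2 * fourierLaplace κ ζ * Complex.I_sq
  have h3 := h₂ ζ
  rw [h2, norm_mul, norm_neg, norm_pow] at h3
  rw [← div_eq_mul_inv, le_div_iff₀ (by positivity)]
  have hre : ζ.re ^ 2 ≤ ‖ζ‖ ^ 2 := by
    rw [← sq_abs]
    exact pow_le_pow_left₀ (abs_nonneg _) (Complex.abs_re_le_norm _) 2
  have e1 : C₁ * Real.exp (R₁ * |ζ.im|) ≤ |C₁| * Real.exp ((R₁ + R₂) * |ζ.im|) := by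
    gcongr
    · exact le_abs_self _
    · linarith
  have e2 : C₂ * Real.exp (R₂ * |ζ.im|) ≤ |C₂| * Real.exp ((R₁ + R₂) * |ζ.im|) := by
    gcongr
    · exact le_abs_self _
    · linarith
  nlinarith [h₁ ζ, norm_nonneg (fourierLaplace κ ζ),
    mul_le_mul_of_nonneg_right hre (norm_nonneg (fourierLaplace κ ζ))]

/-! ### The product Cauchy weight and tensor products of transforms -/

/-- The weight `∏ (1 + v_j²)⁻¹`. -/
def cauchyWeight {d : ℕ} (v : EuclideanSpace ℝ (Fin d)) : ℝ := ∏ j, (1 + v j ^ 2)⁻¹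

theorem cauchyWeight_pos {d : ℕ} (v : EuclideanSpace ℝ (Fin d)) : 0 < cauchyWeight v :=
  Finset.prod_pos fun j _ => by positivity

theorem cauchyWeight_le_one {d : ℕ} (v : EuclideanSpace ℝ (Fin d)) : cauchyWeight v ≤ 1 :=
  Finset.prod_le_one (fun j _ => by positivity) fun j _ =>
    inv_le_one_of_one_le₀ (by nlinarith [sq_nonneg (v j)])

theorem continuous_cauchyWeight {d : ℕ} :
    Continuous (cauchyWeight : EuclideanSpace ℝ (Fin d) → ℝ) := by
  unfold cauchyWeight
  refine continuous_finsetProd _ fun j _ => Continuous.inv₀ (by fun_prop) fun v => ?_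
  positivity

/-- Peetre's inequality `1 + v² ≤ 2 (1 + u²) (1 + (v - u)²)` in each coordinate. -/
theorem cauchyWeight_sub_le {d : ℕ} (v u : EuclideanSpace ℝ (Fin d)) :
    cauchyWeight (v - u) ≤ (∏ j, 2 * (1 + u j ^ 2)) * cauchyWeight v := by
  unfold cauchyWeight
  rw [← Finset.prod_mul_distrib]
  refine Finset.prod_le_prod (fun j _ => by positivity) fun j _ => ?_
  rw [PiLp.sub_apply, ← div_eq_mul_inv, inv_eq_one_div, div_le_div_iff₀ (by positivity) (by positivity)]
  nlinarith [sq_nonneg (v j - 2 * u j), sq_nonneg (u j * (v j - u j))]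

theorem cauchyWeight_sub_comm {d : ℕ} (v u : EuclideanSpace ℝ (Fin d)) :
    cauchyWeight (v - u) = cauchyWeight (u - v) := by
  unfold cauchyWeight
  refine Finset.prod_congr rfl fun j _ => ?_
  simp only [PiLp.sub_apply]
  congr 2
  ring

/-- The tensor power of the Fourier–Laplace transform of `κ`. -/
def tensorLaplace {d : ℕ} (κ : ℝ → ℂ) (z : EuclideanSpace ℂ (Fin d)) : ℂ :=
  ∏ j, fourierLaplace κ (z j)

/-- The coordinatewise real part. -/
def rePart {d : ℕ} (z : EuclideanSpace ℂ (Fin d)) : EuclideanSpace ℝ (Fin d) :=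
  WithLp.toLp 2 fun j => (z j).re

theorem differentiable_tensorLaplace {d : ℕ} {κ : ℝ → ℂ} (hκ : Continuous κ)
    (hs : HasCompactSupport κ) :
    Differentiable ℂ (tensorLaplace κ : EuclideanSpace ℂ (Fin d) → ℂ) := by
  unfold tensorLaplace
  have : ∀ j : Fin d, Differentiable ℂ fun z : EuclideanSpace ℂ (Fin d) =>
      fourierLaplace κ (z j) := fun j =>
    (differentiable_fourierLaplace hκ hs).comp (by fun_prop)
  exact fun z => (HasFDerivAt.finsetProd fun j _ => (this j z).hasFDerivAt).differentiableAt

theorem continuous_toComplexSpace {d : ℕ} :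
    Continuous (toComplexSpace : EuclideanSpace ℝ (Fin d) → EuclideanSpace ℂ (Fin d)) := by
  unfold toComplexSpace
  fun_prop

theorem exists_norm_tensorLaplace_le {κ : ℝ → ℂ} (hκ : ContDiff ℝ 2 κ)
    (hs : HasCompactSupport κ) (d : ℕ) :
    ∃ C R : ℝ, 0 < C ∧ 0 ≤ R ∧ ∀ (v : EuclideanSpace ℝ (Fin d)) (z : EuclideanSpace ℂ (Fin d)),
      ‖tensorLaplace κ (toComplexSpace v - z)‖ ≤
        C * Real.exp (R * ∑ j, |(z j).im|) * cauchyWeight (v - rePart z) := by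
  obtain ⟨C, R, hC, hR, h⟩ := exists_norm_fourierLaplace_le_inv hκ hs
  refine ⟨(C + 1) ^ d, R, by positivity, hR, fun v z => ?_⟩
  unfold tensorLaplace cauchyWeight
  rw [norm_prod, Finset.mul_sum, Real.exp_sum, show (C + 1) ^ d = ∏ _j : Fin d, (C + 1) by simp,
    ← Finset.prod_mul_distrib, ← Finset.prod_mul_distrib]
  refine Finset.prod_le_prod (fun j _ => norm_nonneg _) fun j _ => (h _).trans ?_
  simp only [toComplexSpace, rePart, PiLp.sub_apply, Complex.sub_im, Complex.ofReal_im, zero_sub,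
    abs_neg, Complex.sub_re, Complex.ofReal_re]
  gcongr
  linarith

theorem exists_norm_tensorLaplace_real_le {κ : ℝ → ℂ} (hκ : ContDiff ℝ 2 κ)
    (hs : HasCompactSupport κ) (d : ℕ) :
    ∃ C : ℝ, 0 < C ∧ ∀ v u : EuclideanSpace ℝ (Fin d),
      ‖tensorLaplace κ (toComplexSpace v - toComplexSpace u)‖ ≤ C * cauchyWeight (v - u) := by
  obtain ⟨C, R, hC, -, h⟩ := exists_norm_tensorLaplace_le hκ hs d
  refine ⟨C, hC, fun v u => (h v _).trans (le_of_eq ?_)⟩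
  have : rePart (toComplexSpace u) = u := by
    ext j
    simp [rePart, toComplexSpace]
  rw [this]
  simp [toComplexSpace]

theorem tensorLaplace_eq_fourierHat {d : ℕ} (κ : ℝ → ℂ) (u : EuclideanSpace ℝ (Fin d)) :
    tensorLaplace κ (toComplexSpace u) = fourierHat (fun t => ∏ j, κ (t j)) u := by
  unfold tensorLaplace fourierHat fourierLaplace
  rw [← integral_fintype_prod_volume_eq_prod (𝕜 := ℂ)
    (fun j (t : ℝ) => Complex.exp (-(Complex.I * (toComplexSpace u j * t))) * κ t),
    ← (EuclideanSpace.volume_preserving_symm_measurableEquiv_toLp (Fin d)).symm.integral_comp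
      (MeasurableEquiv.measurableEmbedding _)]
  refine integral_congr_ae (Filter.Eventually.of_forall fun t => ?_)
  simp only [Finset.prod_mul_distrib]
  rw [← Complex.exp_sum]
  congr 2
  simp [toComplexSpace, PiLp.inner_apply, Finset.mul_sum, mul_comm]

/-! ### Elementary rules for `fourierHat` -/

theorem norm_exp_neg_I_mul_real (x : ℝ) : ‖Complex.exp (-(Complex.I * (x : ℂ)))‖ = 1 := by
  rw [Complex.norm_exp]
  simp

theorem fourierHat_eq_fourier {d : ℕ} (f : EuclideanSpace ℝ (Fin d) → ℂ)
    (u : EuclideanSpace ℝ (Fin d)) :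
    fourierHat f u = FourierTransform.fourier f ((2 * Real.pi)⁻¹ • u) := by
  rw [Real.fourier_eq', fourierHat]
  congr 1
  ext t
  rw [smul_eq_mul, inner_smul_right, real_inner_comm]
  congr 2
  push_cast
  field_simp

theorem integrable_exp_mul {d : ℕ} {f : EuclideanSpace ℝ (Fin d) → ℂ} (hf : Integrable f)
    (u : EuclideanSpace ℝ (Fin d)) :
    Integrable fun t => Complex.exp (-(Complex.I * ((inner ℝ u t : ℝ) : ℂ))) * f t := by
  refine hf.norm.mono' (Continuous.aestronglyMeasurable (by fun_prop) |>.mul hf.1)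
    (Filter.Eventually.of_forall fun t => ?_)
  rw [norm_mul, norm_exp_neg_I_mul_real, one_mul]

theorem norm_fourierHat_le {d : ℕ} (f : EuclideanSpace ℝ (Fin d) → ℂ)
    (u : EuclideanSpace ℝ (Fin d)) : ‖fourierHat f u‖ ≤ ∫ t, ‖f t‖ := by
  refine (norm_integral_le_integral_norm _).trans (le_of_eq ?_)
  congr 1
  ext t
  rw [norm_mul, norm_exp_neg_I_mul_real, one_mul]

theorem continuous_fourierHat {d : ℕ} {f : EuclideanSpace ℝ (Fin d) → ℂ} (hf : Integrable f) :
    Continuous (fourierHat f) := by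
  refine continuous_of_dominated (bound := fun t => ‖f t‖)
    (fun u => (integrable_exp_mul hf u).1) (fun u => Filter.Eventually.of_forall fun t => ?_)
    hf.norm (Filter.Eventually.of_forall fun t => by fun_prop)
  rw [norm_mul, norm_exp_neg_I_mul_real, one_mul]

theorem fourierHat_add {d : ℕ} {f g : EuclideanSpace ℝ (Fin d) → ℂ} (hf : Integrable f)
    (hg : Integrable g) (u : EuclideanSpace ℝ (Fin d)) :
    fourierHat (fun t => f t + g t) u = fourierHat f u + fourierHat g u := by
  simp only [fourierHat, mul_add]
  exact integral_add (integrable_exp_mul hf u) (integrable_exp_mul hg u)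

theorem fourierHat_sub {d : ℕ} {f g : EuclideanSpace ℝ (Fin d) → ℂ} (hf : Integrable f)
    (hg : Integrable g) (u : EuclideanSpace ℝ (Fin d)) :
    fourierHat (fun t => f t - g t) u = fourierHat f u - fourierHat g u := by
  simp only [fourierHat, mul_sub]
  exact integral_sub (integrable_exp_mul hf u) (integrable_exp_mul hg u)

theorem fourierHat_const_mul {d : ℕ} (c : ℂ) (f : EuclideanSpace ℝ (Fin d) → ℂ)
    (u : EuclideanSpace ℝ (Fin d)) :
    fourierHat (fun t => c * f t) u = c * fourierHat f u := by
  simp only [fourierHat, ← integral_const_mul]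
  congr 1
  ext t
  ring

theorem fourierHat_conj {d : ℕ} (f : EuclideanSpace ℝ (Fin d) → ℂ)
    (u : EuclideanSpace ℝ (Fin d)) :
    fourierHat (fun t => conj (f t)) u = conj (fourierHat f (-u)) := by
  simp only [fourierHat]
  rw [← integral_conj]
  congr 1
  ext t
  rw [map_mul, ← Complex.exp_conj]
  simp

theorem fourierHat_exp_mul {d : ℕ} (f : EuclideanSpace ℝ (Fin d) → ℂ)
    (a u : EuclideanSpace ℝ (Fin d)) :
    fourierHat (fun t => Complex.exp (Complex.I * ((inner ℝ a t : ℝ) : ℂ)) * f t) u =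
      fourierHat f (u - a) := by
  simp only [fourierHat]
  congr 1
  ext t
  rw [← mul_assoc, ← Complex.exp_add, inner_sub_left]
  congr 2
  push_cast
  ring

/-! ### Admissible integrands and complex variances -/

theorem IsBddCompact.integrable {d : ℕ} {F : Type*} [NormedAddCommGroup F] [MeasurableSpace F]
    [BorelSpace F] [SecondCountableTopology F]
    {f : EuclideanSpace ℝ (Fin d) → F} (hf : IsBddCompact f) : Integrable f := by
  obtain ⟨hm, ⟨C, hC⟩, hs⟩ := hf
  have : IntegrableOn f (tsupport f) := by
    refine Measure.integrableOn_of_bounded (M := C) hs.isCompact.measure_lt_top.ne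
      hm.aestronglyMeasurable (Filter.Eventually.of_forall hC)
  exact (integrableOn_iff_integrable_of_support_subset (subset_tsupport f)).1 this

theorem IsBddCompact.of_test {d : ℕ} {U : Set (EuclideanSpace ℝ (Fin d))}
    {h : EuclideanSpace ℝ (Fin d) → ℂ} (hh : h ∈ testFunctions U) : IsBddCompact h := by
  refine ⟨hh.1.continuous.measurable, ?_, hh.2.1⟩
  obtain ⟨C, hC⟩ := hh.1.continuous.bounded_above_of_compact_support hh.2.1
  exact ⟨C, hC⟩

section BddCompact

variable {d : ℕ} {f g : EuclideanSpace ℝ (Fin d) → ℂ}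

theorem IsBddCompact.sub (hf : IsBddCompact f) (hg : IsBddCompact g) :
    IsBddCompact fun x => f x - g x := by
  obtain ⟨hm, ⟨C, hC⟩, hs⟩ := hf
  obtain ⟨hm', ⟨C', hC'⟩, hs'⟩ := hg
  refine ⟨hm.sub hm', ⟨C + C', fun x => (norm_sub_le _ _).trans (add_le_add (hC x) (hC' x))⟩, ?_⟩
  exact hs.sub hs'

theorem IsBddCompact.re (hf : IsBddCompact f) : IsBddCompact fun x => (f x).re := by
  obtain ⟨hm, ⟨C, hC⟩, hs⟩ := hf
  exact ⟨Complex.measurable_re.comp hm, ⟨C, fun x => (Complex.abs_re_le_norm _).trans (hC x)⟩,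
    hs.comp_left Complex.zero_re⟩

theorem IsBddCompact.im (hf : IsBddCompact f) : IsBddCompact fun x => (f x).im := by
  obtain ⟨hm, ⟨C, hC⟩, hs⟩ := hf
  exact ⟨Complex.measurable_im.comp hm, ⟨C, fun x => (Complex.abs_im_le_norm _).trans (hC x)⟩,
    hs.comp_left Complex.zero_im⟩

theorem IsBddCompact.conj (hf : IsBddCompact f) : IsBddCompact fun x => conj (f x) := by
  obtain ⟨hm, ⟨C, hC⟩, hs⟩ := hf
  exact ⟨Complex.continuous_conj.measurable.comp hm, ⟨C, fun x => by simpa using hC x⟩,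
    hs.comp_left (map_zero _)⟩

theorem IsBddCompact.bdd_mul (hf : IsBddCompact f) (hm' : Measurable g) {C : ℝ}
    (hC' : ∀ x, ‖g x‖ ≤ C) : IsBddCompact fun x => g x * f x := by
  obtain ⟨hm, ⟨C', hC⟩, hs⟩ := hf
  refine ⟨hm'.mul hm, ⟨C * C', fun x => ?_⟩, hs.mul_left⟩
  rw [norm_mul]
  exact mul_le_mul (hC' x) (hC x) (norm_nonneg _) ((norm_nonneg _).trans (hC' x))

theorem IsBddCompact.indicator {A : Set (EuclideanSpace ℝ (Fin d))} (hA : MeasurableSet A)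
    (hf : IsBddCompact f) : IsBddCompact (A.indicator f) := by
  obtain ⟨hm, ⟨C, hC⟩, hs⟩ := hf
  refine ⟨hm.indicator hA, ⟨C, fun x => (norm_indicator_le_norm_self _ _).trans (hC x)⟩, ?_⟩
  exact hs.mono (by rw [Set.support_indicator]; exact Set.inter_subset_right)

end BddCompact

theorem StatRandomMeasure.integral_sub {Ω : Type*} [MeasurableSpace Ω] {P : Measure Ω} {d : ℕ}
    (M : StatRandomMeasure P d) {f g : EuclideanSpace ℝ (Fin d) → ℝ} (hf : IsBddCompact f)
    (hg : IsBddCompact g) :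
    ∀ᵐ ω ∂P, M.integral (fun x => f x - g x) ω = M.integral f ω - M.integral g ω := by
  have := M.linear (-1) g f hg hf
  filter_upwards [this] with ω h
  rw [show (fun x => f x - g x) = fun x => -1 * g x + f x by ext; ring, h]
  ring

theorem complexVariance_add_I_mul {Ω : Type*} [MeasurableSpace Ω] {P : Measure Ω}
    [IsProbabilityMeasure P] {X Y : Ω → ℝ} (hX : MemLp X 2 P) (hY : MemLp Y 2 P) :
    complexVariance P (fun ω => (X ω : ℂ) + Complex.I * Y ω) = Var[X; P] + Var[Y; P] := by
  have hXi : Integrable X P := hX.integrable (by norm_num)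
  have hYi : Integrable Y P := hY.integrable (by norm_num)
  rw [variance_eq_integral hX.1.aemeasurable, variance_eq_integral hY.1.aemeasurable,
    complexVariance, ← integral_add]
  · congr 1
    ext ω
    rw [integral_add hXi.ofReal (hYi.ofReal.const_mul _), integral_const_mul,
      integral_complex_ofReal, integral_complex_ofReal, ← Complex.normSq_eq_norm_sq,
      Complex.normSq_apply]
    simp
    ring
  · exact (hX.sub (memLp_const _)).integrable_sq
  · exact (hY.sub (memLp_const _)).integrable_sq

/-! ### The variance formula for complex integrands -/

section Variance

variable {Ω : Type*} [MeasurableSpace Ω] {P : Measure Ω} {d : ℕ}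
  {M : StatRandomMeasure P d} {S : Measure (EuclideanSpace ℝ (Fin d))}

theorem lintegral_neg_of_even (hS : S.map (fun u => -u) = S)
    (f : EuclideanSpace ℝ (Fin d) → ENNReal) : ∫⁻ u, f (-u) ∂S = ∫⁻ u, f u ∂S := by
  conv_rhs => rw [← hS]
  exact (lintegral_map_equiv f (MeasurableEquiv.neg _)).symm

theorem enorm_sq_add_enorm_sq_conj (a b : ℂ) :
    ‖a + Complex.I * b‖ₑ ^ 2 + ‖a - Complex.I * b‖ₑ ^ 2 = 2 * (‖a‖ₑ ^ 2 + ‖b‖ₑ ^ 2) := by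
  have h : ‖a + Complex.I * b‖ ^ 2 + ‖a - Complex.I * b‖ ^ 2 = 2 * (‖a‖ ^ 2 + ‖b‖ ^ 2) := by
    simp only [← Complex.normSq_eq_norm_sq, Complex.normSq_apply]
    simp
    ring
  have h2 : (‖a + Complex.I * b‖₊ ^ 2 + ‖a - Complex.I * b‖₊ ^ 2 : NNReal) =
      2 * (‖a‖₊ ^ 2 + ‖b‖₊ ^ 2) := NNReal.eq (by simpa using h)
  simp only [enorm_eq_nnnorm]
  exact_mod_cast h2

/-- Write `r`, `i` for the transforms of the real and imaginary parts. Then `f̂(u) = r + I i`, while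
`f̂(-u)` has the modulus of `r - I i`. Since `S` is even, averaging over `u` and `-u` removes the
cross term by the parallelogram law. -/
theorem IsSpectralMeasure.lintegral_fourierHat (hS : IsSpectralMeasure M S)
    {f : EuclideanSpace ℝ (Fin d) → ℂ} (hf : IsBddCompact f) :
    ∫⁻ u, ‖fourierHat f u‖ₑ ^ 2 ∂S = ENNReal.ofReal
      (Var[M.integral (fun x => (f x).re); P] + Var[M.integral (fun x => (f x).im); P]) := by
  have hr : Integrable (fun x => ((f x).re : ℂ)) := hf.re.integrable.ofReal
  have hi : Integrable (fun x => ((f x).im : ℂ)) := hf.im.integrable.ofReal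
  have h1 : ∀ u, fourierHat f u = fourierHat (fun x => ((f x).re : ℂ)) u +
      Complex.I * fourierHat (fun x => ((f x).im : ℂ)) u := by
    intro u
    rw [← fourierHat_const_mul, ← fourierHat_add hr (hi.const_mul _)]
    congr 1
    ext x
    rw [mul_comm, Complex.re_add_im]
  have hc : ∀ (g : EuclideanSpace ℝ (Fin d) → ℝ) (u), fourierHat (fun x => (g x : ℂ)) (-u) =
      conj (fourierHat (fun x => (g x : ℂ)) u) := by
    intro g u
    have := fourierHat_conj (fun x => (g x : ℂ)) (-u)
    simpa using this
  have h2 : ∀ u, ‖fourierHat f (-u)‖ₑ = ‖fourierHat (fun x => ((f x).re : ℂ)) u -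
      Complex.I * fourierHat (fun x => ((f x).im : ℂ)) u‖ₑ := by
    intro u
    rw [h1, hc, hc, ← RCLike.enorm_conj (_ + _)]
    simp [sub_eq_add_neg]
  have hm : ∀ {g : EuclideanSpace ℝ (Fin d) → ℂ}, Integrable g →
      Measurable fun u => ‖fourierHat g u‖ₑ ^ 2 := fun hg =>
    (continuous_fourierHat hg).measurable.enorm.pow_const 2
  have h3 : 2 * ∫⁻ u, ‖fourierHat f u‖ₑ ^ 2 ∂S =
      2 * (∫⁻ u, ‖fourierHat (fun x => ((f x).re : ℂ)) u‖ₑ ^ 2 ∂S +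
        ∫⁻ u, ‖fourierHat (fun x => ((f x).im : ℂ)) u‖ₑ ^ 2 ∂S) := by
    rw [two_mul, ← lintegral_add_left (hm hr), ← lintegral_const_mul' _ _ (by simp)]
    nth_rewrite 2 [← lintegral_neg_of_even hS.even]
    rw [← lintegral_add_left (hm hf.integrable)]
    refine lintegral_congr fun u => ?_
    rw [h2, h1]
    exact enorm_sq_add_enorm_sq_conj _ _
  rw [(ENNReal.mul_right_inj (by simp) (by simp)).1 h3, hS.variance_eq _ hf.re,
    hS.variance_eq _ hf.im, ENNReal.ofReal_add (variance_nonneg _ _) (variance_nonneg _ _)]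

theorem IsSpectralMeasure.memLp_fourierHat (hS : IsSpectralMeasure M S)
    {f : EuclideanSpace ℝ (Fin d) → ℂ} (hf : IsBddCompact f) : MemLp (fourierHat f) 2 S := by
  refine ⟨(continuous_fourierHat hf.integrable).aestronglyMeasurable, ?_⟩
  rw [eLpNorm_lt_top_iff_lintegral_rpow_enorm_lt_top (by simp) (by simp)]
  have := hS.lintegral_fourierHat hf
  simp only [ENNReal.toReal_ofNat, ENNReal.rpow_ofNat]
  rw [this]
  exact ENNReal.ofReal_lt_top

theorem IsSpectralMeasure.complexVariance_sub [IsProbabilityMeasure P]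
    (hS : IsSpectralMeasure M S) {f g : EuclideanSpace ℝ (Fin d) → ℂ}
    (hf : IsBddCompact f) (hg : IsBddCompact g) :
    ENNReal.ofReal (complexVariance P (fun ω => M.cintegral f ω - M.cintegral g ω)) =
      ∫⁻ u, ‖fourierHat f u - fourierHat g u‖ₑ ^ 2 ∂S := by
  simp_rw [← fourierHat_sub hf.integrable hg.integrable]
  rw [hS.lintegral_fourierHat (hf.sub hg), ← complexVariance_add_I_mul
    (M.memLp _ (hf.sub hg).re) (M.memLp _ (hf.sub hg).im)]
  congr 1
  have hae : (fun ω => M.cintegral f ω - M.cintegral g ω) =ᵐ[P] fun ω =>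
      (M.integral (fun x => (f x - g x).re) ω : ℂ) +
        Complex.I * M.integral (fun x => (f x - g x).im) ω := by
    filter_upwards [M.integral_sub hf.re hg.re, M.integral_sub hf.im hg.im] with ω h1 h2
    simp only [Complex.sub_re, Complex.sub_im, h1, h2, StatRandomMeasure.cintegral]
    push_cast
    ring
  unfold complexVariance
  rw [integral_congr_ae hae]
  refine integral_congr_ae ?_
  filter_upwards [hae] with ω h
  rw [h]

theorem complexVariance_nonneg (X : Ω → ℂ) : 0 ≤ complexVariance P X :=
  integral_nonneg fun _ => by positivity

end Variance

/-! ### An admissible function whose transform dominates the Cauchy weight -/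

theorem hasCompactSupport_prod {d : ℕ} {κ : ℝ → ℂ} (hs : HasCompactSupport κ) :
    HasCompactSupport fun t : EuclideanSpace ℝ (Fin d) => ∏ j, κ (t j) := by
  obtain ⟨R, hR⟩ := hs.isCompact.isBounded.exists_norm_le
  refine HasCompactSupport.intro
    (isCompact_closedBall (0 : EuclideanSpace ℝ (Fin d)) (√(∑ _j : Fin d, R ^ 2))) fun t ht => ?_
  by_contra hne
  refine ht ?_
  rw [mem_closedBall_zero_iff, EuclideanSpace.norm_eq]
  refine Real.sqrt_le_sqrt (Finset.sum_le_sum fun j _ => ?_)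
  have hj : κ (t j) ≠ 0 := Finset.prod_ne_zero_iff.1 hne j (Finset.mem_univ j)
  exact pow_le_pow_left₀ (norm_nonneg _) (hR _ (subset_tsupport _ hj)) 2

/-- The truncated exponential on the unit interval. -/
def truncExp : ℝ → ℂ := (Set.Icc (0 : ℝ) 1).indicator fun t => (Real.exp (-t) : ℂ)

theorem measurable_truncExp : Measurable truncExp :=
  Measurable.indicator (by fun_prop) measurableSet_Icc

theorem norm_truncExp_le (t : ℝ) : ‖truncExp t‖ ≤ 1 := by
  unfold truncExp
  by_cases ht : t ∈ Set.Icc (0 : ℝ) 1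
  · rw [Set.indicator_of_mem ht, Complex.norm_real, Real.norm_eq_abs, Real.abs_exp]
    exact Real.exp_le_one_iff.2 (by linarith [ht.1])
  · simp [Set.indicator_of_notMem ht]

theorem hasCompactSupport_truncExp : HasCompactSupport truncExp :=
  HasCompactSupport.intro isCompact_Icc fun _ ht => Set.indicator_of_notMem ht _

theorem fourierLaplace_truncExp (x : ℝ) :
    fourierLaplace truncExp x =
      (1 - Complex.exp (-(1 + Complex.I * x))) / (1 + Complex.I * x) := by
  have hne : (1 + Complex.I * x : ℂ) ≠ 0 := fun h => by simpa using congrArg Complex.re h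
  have h1 : fourierLaplace truncExp x =
      ∫ t in (0 : ℝ)..1, Complex.exp (-(1 + Complex.I * x) * t) := by
    rw [intervalIntegral.integral_of_le zero_le_one, ← integral_Icc_eq_integral_Ioc,
      ← integral_indicator measurableSet_Icc]
    unfold fourierLaplace truncExp
    congr 1
    ext t
    by_cases ht : t ∈ Set.Icc (0 : ℝ) 1
    · rw [Set.indicator_of_mem ht, Set.indicator_of_mem ht, Complex.ofReal_exp, ← Complex.exp_add]
      congr 1
      push_cast
      ring
    · rw [Set.indicator_of_notMem ht, Set.indicator_of_notMem ht, mul_zero]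
  rw [h1, integral_exp_mul_complex (neg_ne_zero.2 hne)]
  simp only [Complex.ofReal_one, mul_one, Complex.ofReal_zero, mul_zero, Complex.exp_zero]
  rw [div_neg, ← neg_div, neg_sub]

/-- The numerator stays away from 0 because the exponential in it has modulus `e⁻¹ < 1`. This is why
a truncated exponential is used: the transform of a plain interval indicator has real zeros and
could not dominate the Cauchy weight. -/
theorem le_norm_fourierLaplace_truncExp (x : ℝ) :
    (1 - Real.exp (-1)) ^ 2 * (1 + x ^ 2)⁻¹ ≤ ‖fourierLaplace truncExp x‖ ^ 2 := by
  have hpos : 0 ≤ 1 - Real.exp (-1) := by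
    have := Real.exp_le_one_iff.2 (show (-1 : ℝ) ≤ 0 by norm_num)
    linarith
  have hden : ‖(1 + Complex.I * x : ℂ)‖ ^ 2 = 1 + x ^ 2 := by
    rw [← Complex.normSq_eq_norm_sq, Complex.normSq_apply]
    simp
    ring
  rw [fourierLaplace_truncExp, norm_div, div_pow, hden, ← div_eq_mul_inv]
  gcongr
  have h := norm_sub_norm_le (1 : ℂ) (Complex.exp (-(1 + Complex.I * x)))
  rw [norm_one, Complex.norm_exp] at h
  simpa using h

theorem isBddCompact_prod_truncExp (d : ℕ) :
    IsBddCompact fun t : EuclideanSpace ℝ (Fin d) => ∏ j, truncExp (t j) := by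
  refine ⟨Finset.measurable_fun_prod _ fun j _ => measurable_truncExp.comp (by fun_prop),
    ⟨1, fun t => ?_⟩, hasCompactSupport_prod hasCompactSupport_truncExp⟩
  rw [norm_prod]
  exact Finset.prod_le_one (fun j _ => norm_nonneg _) fun j _ => norm_truncExp_le _

theorem le_norm_fourierHat_prod_truncExp {d : ℕ} (u : EuclideanSpace ℝ (Fin d)) :
    ((1 - Real.exp (-1)) ^ 2) ^ d * cauchyWeight u ≤
      ‖fourierHat (fun t => ∏ j, truncExp (t j)) u‖ ^ 2 := by
  rw [← tensorLaplace_eq_fourierHat, tensorLaplace, norm_prod, ← Finset.prod_pow, cauchyWeight,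
    show ((1 - Real.exp (-1)) ^ 2) ^ d = ∏ _j : Fin d, (1 - Real.exp (-1)) ^ 2 by simp,
    ← Finset.prod_mul_distrib]
  exact Finset.prod_le_prod (fun j _ => by positivity) fun j _ =>
    le_norm_fourierLaplace_truncExp (u j)

/-! ### Translation boundedness of the spectral measure -/

section Bound

variable {Ω : Type*} [MeasurableSpace Ω] {P : Measure Ω} {d : ℕ}
  {M : StatRandomMeasure P d} {S : Measure (EuclideanSpace ℝ (Fin d))}

theorem isBddCompact_bcf_mul {e : EuclideanSpace ℝ (Fin d) → ℂ} (he : IsBddCompact e)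
    (f : BoundedContinuousFunction (EuclideanSpace ℝ (Fin d)) ℂ) :
    IsBddCompact fun x => f x * e x :=
  he.bdd_mul f.continuous.measurable f.norm_coe_le_norm

/-- The map `f ↦ (f e)^` from bounded continuous functions to `L²(S)`. -/
def IsSpectralMeasure.mulHat (hS : IsSpectralMeasure M S) {e : EuclideanSpace ℝ (Fin d) → ℂ}
    (he : IsBddCompact e) :
    BoundedContinuousFunction (EuclideanSpace ℝ (Fin d)) ℂ →ₗ[ℂ] Lp ℂ 2 S where
  toFun f := (hS.memLp_fourierHat (isBddCompact_bcf_mul he f)).toLp _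
  map_add' f g := by
    rw [← MemLp.toLp_add]
    congr 1
    ext u
    simp only [BoundedContinuousFunction.coe_add, Pi.add_apply, add_mul]
    exact fourierHat_add (isBddCompact_bcf_mul he f).integrable
      (isBddCompact_bcf_mul he g).integrable u
  map_smul' c f := by
    rw [RingHom.id_apply, ← MemLp.toLp_const_smul]
    congr 1
    ext u
    simp only [BoundedContinuousFunction.coe_smul, smul_eq_mul, mul_assoc, Pi.smul_apply]
    exact fourierHat_const_mul c _ u

/-- Closed graph theorem: uniform convergence of `f n` forces pointwise convergence of the
transforms of `f n * e`, and an `L²` limit is an almost everywhere limit along a subsequence, so the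
two limits agree. -/
theorem IsSpectralMeasure.continuous_mulHat (hS : IsSpectralMeasure M S)
    {e : EuclideanSpace ℝ (Fin d) → ℂ} (he : IsBddCompact e) : Continuous (hS.mulHat he) := by
  refine LinearMap.continuous_of_seq_closed_graph _ fun f g y hf hy => ?_
  have hm := tendstoInMeasure_of_tendsto_Lp hy
  obtain ⟨ns, hns, hae⟩ := hm.exists_seq_tendsto_ae
  refine Lp.ext ?_
  have hco : ∀ n, (hS.mulHat he (f n) : EuclideanSpace ℝ (Fin d) → ℂ) =ᵐ[S]
      fourierHat fun x => f n x * e x := fun n =>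
    (hS.memLp_fourierHat (isBddCompact_bcf_mul he (f n))).coeFn_toLp
  filter_upwards [hae, ae_all_iff.2 hco,
    (hS.memLp_fourierHat (isBddCompact_bcf_mul he g)).coeFn_toLp] with u h1 h2 h3
  refine tendsto_nhds_unique h1 ?_
  have h3' : (hS.mulHat he g : EuclideanSpace ℝ (Fin d) → ℂ) u =
    fourierHat (fun x => g x * e x) u := h3
  rw [h3']
  simp only [Function.comp_apply, h2]
  have hlim : Filter.Tendsto (fun n => fourierHat (fun x => f n x * e x) u) Filter.atTop
      (nhds (fourierHat (fun x => g x * e x) u)) := by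
    rw [tendsto_iff_norm_sub_tendsto_zero]
    have hb : Filter.Tendsto (fun n => ‖f n - g‖ * ∫ t, ‖e t‖) Filter.atTop (nhds 0) := by
      simpa using (tendsto_iff_norm_sub_tendsto_zero.1 hf).mul_const (∫ t, ‖e t‖)
    refine squeeze_zero (fun _ => norm_nonneg _) (fun n => ?_) hb
    rw [← fourierHat_sub (isBddCompact_bcf_mul he (f n)).integrable
      (isBddCompact_bcf_mul he g).integrable]
    refine (norm_fourierHat_le _ _).trans ?_
    rw [← integral_const_mul]
    refine integral_mono (((isBddCompact_bcf_mul he (f n)).integrable.sub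
      (isBddCompact_bcf_mul he g).integrable).norm) (he.integrable.norm.const_mul _) fun x => ?_
    simp only
    rw [← sub_mul, norm_mul]
    exact mul_le_mul_of_nonneg_right ((f n - g).norm_coe_le_norm x) (norm_nonneg _)
  exact hlim.comp hns.tendsto_atTop

/-- Translating `ê` by `u` amounts to multiplying `e` by a character, which has sup norm at most 1.
The squared operator norm of `hS.mulHat he` is therefore a bound independent of `u`. -/
theorem IsSpectralMeasure.exists_lintegral_fourierHat_sub_le (hS : IsSpectralMeasure M S)
    {e : EuclideanSpace ℝ (Fin d) → ℂ} (he : IsBddCompact e) :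
    ∃ C : ℝ, ∀ u, ∫⁻ v, ‖fourierHat e (v - u)‖ₑ ^ 2 ∂S ≤ ENNReal.ofReal C := by
  let T : BoundedContinuousFunction (EuclideanSpace ℝ (Fin d)) ℂ →L[ℂ] Lp ℂ 2 S :=
    ⟨hS.mulHat he, hS.continuous_mulHat he⟩
  refine ⟨‖T‖ ^ 2, fun u => ?_⟩
  let f : BoundedContinuousFunction (EuclideanSpace ℝ (Fin d)) ℂ :=
    BoundedContinuousFunction.ofNormedAddCommGroup
      (fun t => Complex.exp (Complex.I * ((inner ℝ u t : ℝ) : ℂ))) (by fun_prop) 1 fun t => by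
        rw [Complex.norm_exp]
        simp
  have hf : ‖f‖ ≤ 1 := BoundedContinuousFunction.norm_ofNormedAddCommGroup_le _ zero_le_one _
  have hT : ‖T f‖ ≤ ‖T‖ := (T.le_opNorm f).trans (mul_le_of_le_one_right (norm_nonneg _) hf)
  have h1 : ‖T f‖ₑ ^ 2 = ∫⁻ v, ‖fourierHat e (v - u)‖ₑ ^ 2 ∂S := by
    rw [Lp.enorm_def, eLpNorm_eq_lintegral_rpow_enorm_toReal (by simp) (by simp)]
    simp only [ENNReal.toReal_ofNat, ENNReal.rpow_ofNat]
    rw [← ENNReal.rpow_ofNat, ← ENNReal.rpow_mul]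
    norm_num
    refine lintegral_congr_ae ?_
    filter_upwards [(hS.memLp_fourierHat (isBddCompact_bcf_mul he f)).coeFn_toLp] with v hv
    have hv' : (T f : EuclideanSpace ℝ (Fin d) → ℂ) v = fourierHat (fun x => f x * e x) v := hv
    rw [hv']
    congr 2
    exact fourierHat_exp_mul e u v
  rw [← h1, ← ofReal_norm, ← ENNReal.ofReal_pow (norm_nonneg _)]
  exact ENNReal.ofReal_le_ofReal (pow_le_pow_left₀ (norm_nonneg _) hT 2)

theorem IsSpectralMeasure.exists_lintegral_cauchyWeight_sub_le (hS : IsSpectralMeasure M S) :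
    ∃ C : ℝ, 0 < C ∧ ∀ u, ∫⁻ v, ENNReal.ofReal (cauchyWeight (v - u)) ∂S ≤ ENNReal.ofReal C := by
  obtain ⟨C, hC⟩ := hS.exists_lintegral_fourierHat_sub_le (isBddCompact_prod_truncExp d)
  have hc : 0 < ((1 - Real.exp (-1)) ^ 2) ^ d := by
    have := Real.exp_lt_exp.2 (show (-1 : ℝ) < 0 by norm_num)
    rw [Real.exp_zero] at this
    have : 0 < 1 - Real.exp (-1) := by linarith
    positivity
  set c := ((1 - Real.exp (-1)) ^ 2) ^ d
  -- The sign of `C` is unknown; the absolute value and the added 1 make the constant strictly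
  -- positive.
  refine ⟨c⁻¹ * |C| + 1, by positivity, fun u => ?_⟩
  calc ∫⁻ v, ENNReal.ofReal (cauchyWeight (v - u)) ∂S
      ≤ ∫⁻ v, ENNReal.ofReal c⁻¹ *
          ‖fourierHat (fun t => ∏ j, truncExp (t j)) (v - u)‖ₑ ^ 2 ∂S := by
        refine lintegral_mono fun v => ?_
        rw [← ofReal_norm, ← ENNReal.ofReal_pow (norm_nonneg _),
          ← ENNReal.ofReal_mul (by positivity)]
        refine ENNReal.ofReal_le_ofReal ?_
        rw [inv_mul_eq_div, le_div_iff₀ hc, mul_comm]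
        exact le_norm_fourierHat_prod_truncExp (v - u)
    _ ≤ ENNReal.ofReal c⁻¹ * ENNReal.ofReal C := by
        rw [lintegral_const_mul' _ _ (by simp)]
        gcongr
        exact hC u
    _ = ENNReal.ofReal (c⁻¹ * C) := (ENNReal.ofReal_mul (by positivity)).symm
    _ ≤ ENNReal.ofReal (c⁻¹ * |C| + 1) := by
        refine ENNReal.ofReal_le_ofReal ?_
        have : c⁻¹ * C ≤ c⁻¹ * |C| := by
          gcongr
          exact le_abs_self C
        linarith

end Bound

/-! ### Cutoffs, Fourier inversion and the convolution formula -/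

theorem exists_tensor_cutoff {d : ℕ} {A : Set (EuclideanSpace ℝ (Fin d))} (hA : IsCompact A) :
    ∃ κ : ℝ → ℂ, ContDiff ℝ ((⊤ : ℕ∞) : WithTop ℕ∞) κ ∧ HasCompactSupport κ ∧
      ∃ U, IsOpen U ∧ A ⊆ U ∧ ∀ t ∈ U, ∏ j, κ (t j) = 1 := by
  obtain ⟨R, hR⟩ := hA.isBounded.exists_norm_le
  let b : ContDiffBump (0 : ℝ) := ⟨|R| + 1, |R| + 2, by positivity, by linarith⟩
  refine ⟨fun t => (b t : ℂ), Complex.ofRealCLM.contDiff.comp b.contDiff,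
    b.hasCompactSupport.comp_left Complex.ofReal_zero, Metric.ball 0 (|R| + 1),
    Metric.isOpen_ball, fun t ht => ?_, fun t ht => ?_⟩
  · rw [mem_ball_zero_iff]
    linarith [hR t ht, le_abs_self R]
  · refine Finset.prod_eq_one fun j _ => ?_
    change ((b (t j) : ℝ) : ℂ) = 1
    rw [b.one_of_mem_closedBall, Complex.ofReal_one]
    rw [mem_closedBall_zero_iff]
    rw [mem_ball_zero_iff] at ht
    exact (PiLp.norm_apply_le t j).trans ht.le

theorem contDiff_tensor {d : ℕ} {κ : ℝ → ℂ} {n : WithTop ℕ∞} (hκ : ContDiff ℝ n κ) :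
    ContDiff ℝ n fun t : EuclideanSpace ℝ (Fin d) => ∏ j, κ (t j) :=
  contDiff_prod fun j _ => hκ.comp (by fun_prop)

theorem one_sub_mul_mem_testFunctions {d : ℕ} {A U V : Set (EuclideanSpace ℝ (Fin d))}
    {χ h : EuclideanSpace ℝ (Fin d) → ℂ} (hχ : ContDiff ℝ ((⊤ : ℕ∞) : WithTop ℕ∞) χ)
    (hU : IsOpen U) (hAU : A ⊆ U) (h1 : ∀ t ∈ U, χ t = 1) (hh : h ∈ testFunctions V) :
    (fun t => h t - χ t * h t) ∈ testFunctions Aᶜ := by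
  refine ⟨hh.1.sub (hχ.mul hh.1), hh.2.1.sub hh.2.1.mul_left, ?_⟩
  refine (closure_minimal (t := Uᶜ) ?_ hU.isClosed_compl).trans (Set.compl_subset_compl.2 hAU)
  intro t ht htU
  exact ht (by simp [h1 t htU])

theorem integrable_fourierHat {d : ℕ} {U : Set (EuclideanSpace ℝ (Fin d))}
    {h : EuclideanSpace ℝ (Fin d) → ℂ} (hh : h ∈ testFunctions U) :
    Integrable (fourierHat h) := by
  have h1 : Integrable (FourierTransform.fourier h) := by
    have := (FourierTransform.fourier (hh.2.1.toSchwartzMap hh.1)).integrable (μ := volume)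
    rw [SchwartzMap.fourier_coe] at this
    exact this
  have h2 := (integrable_comp_smul_iff volume (FourierTransform.fourier h)
    (inv_ne_zero (by positivity : (2 * Real.pi) ≠ 0))).2 h1
  exact h2.congr (Filter.Eventually.of_forall fun u => (fourierHat_eq_fourier h u).symm)

theorem eq_integral_fourierHat {d : ℕ} {U : Set (EuclideanSpace ℝ (Fin d))}
    {h : EuclideanSpace ℝ (Fin d) → ℂ} (hh : h ∈ testFunctions U) (t : EuclideanSpace ℝ (Fin d)) :
    h t = ((2 * Real.pi) ^ d : ℝ)⁻¹ *
      ∫ u, Complex.exp (Complex.I * ((inner ℝ u t : ℝ) : ℂ)) * fourierHat h u := by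
  have hpi : (0 : ℝ) < 2 * Real.pi := by positivity
  have h1 : Integrable (FourierTransform.fourier h) := by
    have := (FourierTransform.fourier (hh.2.1.toSchwartzMap hh.1)).integrable (μ := volume)
    rw [SchwartzMap.fourier_coe] at this
    exact this
  have h2 := congrFun (hh.1.continuous.fourierInv_fourier_eq (IsBddCompact.of_test hh).integrable h1) t
  rw [Real.fourierInv_eq'] at h2
  have h3 := Measure.integral_comp_smul (volume : Measure (EuclideanSpace ℝ (Fin d)))
    (fun v => Complex.exp (((2 * Real.pi * inner ℝ v t : ℝ) : ℂ) * Complex.I) •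
      FourierTransform.fourier h v) (2 * Real.pi)⁻¹
  rw [h2] at h3
  rw [show (∫ u, Complex.exp (Complex.I * ((inner ℝ u t : ℝ) : ℂ)) * fourierHat h u) =
    |(((2 * Real.pi)⁻¹) ^ Module.finrank ℝ (EuclideanSpace ℝ (Fin d)))⁻¹| • h t by
      rw [← h3]
      congr 1
      ext u
      rw [fourierHat_eq_fourier, smul_eq_mul, inner_smul_left]
      congr 2
      simp only [conj_trivial]
      push_cast
      field_simp]
  rw [finrank_euclideanSpace, Fintype.card_fin, inv_pow, inv_inv, abs_of_pos (by positivity),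
    Complex.real_smul, ← mul_assoc, ← Complex.ofReal_mul, inv_mul_cancel₀ (by positivity),
    Complex.ofReal_one, one_mul]

theorem fourierHat_def {d : ℕ} (f : EuclideanSpace ℝ (Fin d) → ℂ)
    (u : EuclideanSpace ℝ (Fin d)) :
    fourierHat f u = ∫ t, Complex.exp (-(Complex.I * ((inner ℝ u t : ℝ) : ℂ))) * f t :=
  rfl

/-- Insert the inversion formula for `h` and exchange the integrals; inversion is needed for `h`
only, so `χ` need only be integrable. -/
theorem fourierHat_mul_eq {d : ℕ} {U : Set (EuclideanSpace ℝ (Fin d))}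
    {χ h : EuclideanSpace ℝ (Fin d) → ℂ} (hχ : Integrable χ) (hh : h ∈ testFunctions U)
    (v : EuclideanSpace ℝ (Fin d)) :
    fourierHat (fun t => χ t * h t) v =
      ((2 * Real.pi) ^ d : ℝ)⁻¹ * ∫ u, fourierHat h u * fourierHat χ (v - u) := by
  have hint := integrable_fourierHat hh
  have h1 : fourierHat (fun t => χ t * h t) v = ((2 * Real.pi) ^ d : ℝ)⁻¹ *
      ∫ t, ∫ u, (Complex.exp (-(Complex.I * ((inner ℝ (v - u) t : ℝ) : ℂ)))) *
        (χ t * fourierHat h u) := by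
    rw [← integral_const_mul, fourierHat_def (fun t => χ t * h t)]
    congr 1
    ext t
    rw [eq_integral_fourierHat hh t]
    simp only [← integral_const_mul]
    congr 1
    ext u
    rw [show Complex.exp (-(Complex.I * ((inner ℝ (v - u) t : ℝ) : ℂ))) =
      Complex.exp (-(Complex.I * ((inner ℝ v t : ℝ) : ℂ))) *
        Complex.exp (Complex.I * ((inner ℝ u t : ℝ) : ℂ)) by
      rw [← Complex.exp_add, inner_sub_left]
      congr 1
      push_cast
      ring]
    ring
  rw [h1, integral_integral_swap]
  · congr 2
    ext u
    rw [fourierHat_def χ, ← integral_const_mul]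
    congr 1
    ext t
    ring
  · refine (hχ.mul_prod hint).mono ?_ (Filter.Eventually.of_forall fun p => ?_)
    · exact (Continuous.aestronglyMeasurable (by fun_prop)).mul (hχ.mul_prod hint).1
    · simp only [Function.uncurry]
      rw [norm_mul, norm_exp_neg_I_mul_real, one_mul]

/-! ### The entire density attached to an orthogonal element -/

/-- The entire function whose Fourier transform is that of the measure `conj φ dS`, for `φ`
orthogonal to the transforms of the test functions supported off the set where `∏ κ (t_j) = 1`. -/
def entireDensity {d : ℕ} (κ : ℝ → ℂ) (S : Measure (EuclideanSpace ℝ (Fin d)))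
    (φ : EuclideanSpace ℝ (Fin d) → ℂ) (z : EuclideanSpace ℂ (Fin d)) : ℂ :=
  ((2 * Real.pi) ^ d : ℝ)⁻¹ * ∫ v, tensorLaplace κ (toComplexSpace v - z) * conj (φ v) ∂S

section Spectral

variable {Ω : Type*} [MeasurableSpace Ω] {P : Measure Ω} {d : ℕ}
  {M : StatRandomMeasure P d} {S : Measure (EuclideanSpace ℝ (Fin d))}
  {φ : EuclideanSpace ℝ (Fin d) → ℂ} {κ : ℝ → ℂ}

theorem lintegral_enorm_sq_lt_top (hφ : MemLp φ 2 S) : ∫⁻ v, ‖φ v‖ₑ ^ 2 ∂S < ⊤ := by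
  have := (eLpNorm_lt_top_iff_lintegral_rpow_enorm_lt_top (by simp) (by simp)).1 hφ.2
  simpa using this

/-- For `0 < w ≤ 1` one has `a w ≤ a² + w`; the first term integrates to the squared `L²` norm of
`φ`, the second is controlled by translation boundedness. -/
theorem IsSpectralMeasure.exists_lintegral_mul_cauchyWeight_le (hS : IsSpectralMeasure M S)
    (hφ : MemLp φ 2 S) : ∃ B : ℝ, 0 ≤ B ∧ ∀ u : EuclideanSpace ℝ (Fin d),
      ∫⁻ v, ‖φ v‖ₑ * ENNReal.ofReal (cauchyWeight (v - u)) ∂S ≤ ENNReal.ofReal B := by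
  obtain ⟨C, hC, h⟩ := hS.exists_lintegral_cauchyWeight_sub_le
  have hfin := lintegral_enorm_sq_lt_top hφ
  refine ⟨(∫⁻ v, ‖φ v‖ₑ ^ 2 ∂S).toReal + C, by positivity, fun u => ?_⟩
  rw [ENNReal.ofReal_add (by positivity) hC.le, ENNReal.ofReal_toReal hfin.ne]
  calc ∫⁻ v, ‖φ v‖ₑ * ENNReal.ofReal (cauchyWeight (v - u)) ∂S
      ≤ ∫⁻ v, (‖φ v‖ₑ ^ 2 + ENNReal.ofReal (cauchyWeight (v - u))) ∂S := by
        refine lintegral_mono fun v => ?_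
        rw [← ofReal_norm, ← ENNReal.ofReal_mul (norm_nonneg _),
          ← ENNReal.ofReal_pow (norm_nonneg _),
          ← ENNReal.ofReal_add (by positivity) (cauchyWeight_pos _).le]
        refine ENNReal.ofReal_le_ofReal ?_
        nlinarith [sq_nonneg (‖φ v‖ - 1), norm_nonneg (φ v), cauchyWeight_pos (v - u),
          cauchyWeight_le_one (v - u), mul_nonneg (norm_nonneg (φ v))
          (sub_nonneg.2 (cauchyWeight_le_one (v - u))), mul_nonneg (sq_nonneg (‖φ v‖))
          (sub_nonneg.2 (cauchyWeight_le_one (v - u))), mul_nonneg (sq_nonneg (‖φ v‖ - 1))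
          (cauchyWeight_pos (v - u)).le]
    _ ≤ _ := by
        rw [lintegral_add_right]
        · gcongr
          exact h u
        · exact ((continuous_cauchyWeight.comp (by fun_prop :
            Continuous fun v : EuclideanSpace ℝ (Fin d) => v - u)).measurable.ennreal_ofReal)

theorem IsSpectralMeasure.integrable_cauchyWeight_mul (hS : IsSpectralMeasure M S)
    (hφ : MemLp φ 2 S) : Integrable (fun v => cauchyWeight v * ‖φ v‖) S := by
  obtain ⟨B, -, hB⟩ := hS.exists_lintegral_mul_cauchyWeight_le hφ
  refine ⟨continuous_cauchyWeight.aestronglyMeasurable.mul hφ.1.norm, ?_⟩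
  refine lt_of_le_of_lt ?_ ((hB 0).trans_lt ENNReal.ofReal_lt_top)
  refine lintegral_mono fun v => le_of_eq ?_
  rw [enorm_mul, enorm_norm, mul_comm, sub_zero, Real.enorm_of_nonneg (cauchyWeight_pos v).le]

theorem sum_abs_im_le (z : EuclideanSpace ℂ (Fin d)) : ∑ j, |(z j).im| ≤ d * ‖z‖ := by
  calc ∑ j, |(z j).im| ≤ ∑ _j : Fin d, ‖z‖ :=
        Finset.sum_le_sum fun j _ => (Complex.abs_im_le_norm _).trans (PiLp.norm_apply_le z j)
    _ = d * ‖z‖ := by simp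

theorem cauchyWeight_sub_rePart_le (v : EuclideanSpace ℝ (Fin d)) {z : EuclideanSpace ℂ (Fin d)}
    {r : ℝ} (hz : ‖z‖ ≤ r) :
    cauchyWeight (v - rePart z) ≤ (2 * (1 + r ^ 2)) ^ d * cauchyWeight v := by
  refine (cauchyWeight_sub_le _ _).trans (mul_le_mul_of_nonneg_right ?_ (cauchyWeight_pos v).le)
  rw [show (2 * (1 + r ^ 2)) ^ d = ∏ _j : Fin d, 2 * (1 + r ^ 2) by simp]
  refine Finset.prod_le_prod (fun j _ => by positivity) fun j _ => ?_
  have h1 : |(z j).re| ≤ r :=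
    (Complex.abs_re_le_norm _).trans ((PiLp.norm_apply_le z j).trans hz)
  have h2 : (z j).re ^ 2 ≤ r ^ 2 := sq_le_sq.2 (h1.trans (le_abs_self r))
  simp only [rePart]
  linarith

theorem IsSpectralMeasure.differentiable_entireDensity (hS : IsSpectralMeasure M S)
    (hφ : MemLp φ 2 S) (hκ : ContDiff ℝ 2 κ) (hs : HasCompactSupport κ) :
    Differentiable ℂ (entireDensity κ S φ) := by
  obtain ⟨C, R, hC, hR, hb⟩ := exists_norm_tensorLaplace_le hκ hs d
  have hk := differentiable_tensorLaplace (d := d) hκ.continuous hs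
  refine Differentiable.const_mul (differentiable_integral_mul_of_dominated
    (f := fun z v => tensorLaplace κ (toComplexSpace v - z)) ?_ (fun v => hk.comp (by fun_prop))
    (Complex.continuous_conj.comp_aestronglyMeasurable hφ.1) fun z₀ =>
      ⟨fun v => C * Real.exp (R * (d * (‖z₀‖ + 2))) *
        ((2 * (1 + (‖z₀‖ + 2) ^ 2)) ^ d * cauchyWeight v), ?_, ?_⟩) _
  · exact hk.continuous.comp ((continuous_toComplexSpace.comp continuous_snd).sub continuous_fst)
  · have := (hS.integrable_cauchyWeight_mul hφ).const_mul
      (C * Real.exp (R * (d * (‖z₀‖ + 2))) * (2 * (1 + (‖z₀‖ + 2) ^ 2)) ^ d)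
    refine this.congr (Filter.Eventually.of_forall fun v => ?_)
    simp only [RCLike.norm_conj]
    ring
  · intro z hz v
    have hz' : ‖z‖ ≤ ‖z₀‖ + 2 := by
      rw [Metric.mem_ball, dist_eq_norm] at hz
      linarith [norm_sub_norm_le z z₀]
    refine (hb v z).trans ?_
    exact mul_le_mul (mul_le_mul_of_nonneg_left (Real.exp_le_exp.2 (mul_le_mul_of_nonneg_left
      ((sum_abs_im_le z).trans (mul_le_mul_of_nonneg_left hz' (by positivity))) hR)) hC.le)
      (cauchyWeight_sub_rePart_le v hz') (cauchyWeight_pos _).le (by positivity)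

theorem enorm_integral_tensorLaplace_le {C : ℝ} (hC : 0 ≤ C) {z : EuclideanSpace ℂ (Fin d)}
    {u : EuclideanSpace ℝ (Fin d)}
    (hb : ∀ v, ‖tensorLaplace κ (toComplexSpace v - z)‖ ≤ C * cauchyWeight (v - u)) :
    ‖∫ v, tensorLaplace κ (toComplexSpace v - z) * conj (φ v) ∂S‖ₑ ≤
      ENNReal.ofReal C * ∫⁻ v, ‖φ v‖ₑ * ENNReal.ofReal (cauchyWeight (v - u)) ∂S := by
  refine (enorm_integral_le_lintegral_enorm _).trans ?_
  rw [← lintegral_const_mul' _ _ ENNReal.ofReal_ne_top]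
  refine lintegral_mono fun v => ?_
  rw [enorm_mul, RCLike.enorm_conj, ← mul_assoc, mul_comm (ENNReal.ofReal C), mul_assoc, mul_comm,
    ← ENNReal.ofReal_mul hC]
  gcongr
  rw [← ofReal_norm]
  exact ENNReal.ofReal_le_ofReal (hb v)

theorem norm_entireDensity (z : EuclideanSpace ℂ (Fin d)) :
    ‖entireDensity κ S φ z‖ = ((2 * Real.pi) ^ d)⁻¹ *
      ‖∫ v, tensorLaplace κ (toComplexSpace v - z) * conj (φ v) ∂S‖ := by
  unfold entireDensity
  rw [norm_mul, Complex.norm_real, Real.norm_of_nonneg (by positivity)]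

/-- The bound involves imaginary parts only, so it gives both exponential type on `ℂ^d` and
boundedness on `ℝ^d`. The real part of `z` merely translates the weight, which costs nothing by
translation boundedness. -/
theorem IsSpectralMeasure.exists_norm_entireDensity_le (hS : IsSpectralMeasure M S)
    (hφ : MemLp φ 2 S) (hκ : ContDiff ℝ 2 κ) (hs : HasCompactSupport κ) :
    ∃ C R : ℝ, 0 ≤ C ∧ 0 ≤ R ∧ ∀ z, ‖entireDensity κ S φ z‖ ≤ C * Real.exp (R * ∑ j, |(z j).im|) := by
  obtain ⟨C, R, hC, hR, hb⟩ := exists_norm_tensorLaplace_le hκ hs d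
  obtain ⟨B, hB0, hB⟩ := hS.exists_lintegral_mul_cauchyWeight_le hφ
  refine ⟨((2 * Real.pi) ^ d)⁻¹ * (C * B), R, by positivity, hR, fun z => ?_⟩
  rw [norm_entireDensity, mul_assoc]
  gcongr
  have := (enorm_integral_tensorLaplace_le (S := S) (φ := φ) (by positivity)
    (fun v => hb v z)).trans (mul_le_mul_right (hB _) _)
  rw [← ofReal_norm, ← ENNReal.ofReal_mul (by positivity),
    ENNReal.ofReal_le_ofReal_iff (by positivity)] at this
  linarith

theorem IsSpectralMeasure.isEntireExpType_entireDensity (hS : IsSpectralMeasure M S)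
    (hφ : MemLp φ 2 S) (hκ : ContDiff ℝ 2 κ) (hs : HasCompactSupport κ) :
    IsEntireExpType fun u => entireDensity κ S φ (toComplexSpace u) := by
  obtain ⟨C, R, hC, hR, hb⟩ := hS.exists_norm_entireDensity_le hφ hκ hs
  refine ⟨_, hS.differentiable_entireDensity hφ hκ hs, ⟨C, R * d, fun z => (hb z).trans ?_⟩,
    fun u => rfl⟩
  rw [mul_assoc R]
  gcongr
  exact sum_abs_im_le z

theorem lintegral_cauchyWeight_sub (v : EuclideanSpace ℝ (Fin d)) :
    ∫⁻ u, ENNReal.ofReal (cauchyWeight (v - u)) = ENNReal.ofReal (Real.pi ^ d) := by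
  simp_rw [cauchyWeight_sub_comm v]
  rw [lintegral_sub_right_eq_self (fun u => ENNReal.ofReal (cauchyWeight u)) v,
    ← ofReal_integral_eq_lintegral_ofReal]
  · congr 1
    rw [← (PiLp.volume_preserving_toLp (Fin d)).integral_comp
      (MeasurableEquiv.toLp 2 (Fin d → ℝ)).measurableEmbedding]
    have := integral_fintype_prod_volume_eq_prod (𝕜 := ℝ) (ι := Fin d)
      (fun _ (x : ℝ) => (1 + x ^ 2)⁻¹)
    simp only [integral_univ_inv_one_add_sq, Finset.prod_const, Finset.card_univ,
      Fintype.card_fin] at this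
    rw [← this]
    rfl
  · rw [← (PiLp.volume_preserving_toLp (Fin d)).integrable_comp_emb
      (MeasurableEquiv.toLp 2 (Fin d → ℝ)).measurableEmbedding]
    exact Integrable.fintype_prod (𝕜 := ℝ) (f := fun (_ : Fin d) (x : ℝ) => (1 + x ^ 2)⁻¹)
      fun _ => integrable_inv_one_add_sq
  · exact Filter.Eventually.of_forall fun u => (cauchyWeight_pos u).le

/-- Cauchy–Schwarz for the splitting `f w = w^{1/2} · (f w^{1/2})`. -/
theorem lintegral_mul_sq_le {α : Type*} [MeasurableSpace α] {μ : Measure α} {f w : α → ENNReal}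
    (hf : AEMeasurable f μ) (hw : AEMeasurable w μ) :
    (∫⁻ v, f v * w v ∂μ) ^ 2 ≤ (∫⁻ v, w v ∂μ) * ∫⁻ v, f v ^ 2 * w v ∂μ := by
  have h := ENNReal.lintegral_mul_le_Lp_mul_Lq μ Real.HolderConjugate.two_two
    (f := fun v => w v ^ (1 / 2 : ℝ)) (g := fun v => f v * w v ^ (1 / 2 : ℝ))
    (hw.pow_const _) (hf.mul (hw.pow_const _))
  have hsq : ∀ x : ENNReal, (x ^ (1 / 2 : ℝ)) ^ (2 : ℝ) = x := fun x => by
    rw [← ENNReal.rpow_mul]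
    norm_num
  have hw2 : ∀ x : ENNReal, x ^ (1 / 2 : ℝ) * x ^ (1 / 2 : ℝ) = x := fun x => by
    rw [← ENNReal.rpow_add_of_nonneg _ _ (by norm_num) (by norm_num)]
    norm_num
  simp only [Pi.mul_apply, hsq, ENNReal.mul_rpow_of_nonneg _ _ zero_le_two] at h
  have h' : ∫⁻ v, f v * w v ∂μ ≤ (∫⁻ v, w v ∂μ) ^ (1 / 2 : ℝ) *
      (∫⁻ v, f v ^ (2 : ℝ) * w v ∂μ) ^ (1 / 2 : ℝ) := by
    refine le_trans (le_of_eq (lintegral_congr fun v => ?_)) h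
    rw [mul_left_comm, hw2]
  calc (∫⁻ v, f v * w v ∂μ) ^ 2 ≤ ((∫⁻ v, w v ∂μ) ^ (1 / 2 : ℝ) *
      (∫⁻ v, f v ^ (2 : ℝ) * w v ∂μ) ^ (1 / 2 : ℝ)) ^ 2 := pow_le_pow_left' h' 2
    _ = _ := by
      rw [← ENNReal.rpow_ofNat, ENNReal.mul_rpow_of_nonneg _ _ (by norm_num)]
      have := hsq
      simp only [ENNReal.rpow_ofNat] at this ⊢
      rw [this, this]

/-- A Schur test. Cauchy–Schwarz in `v` leaves one factor `∫ cauchyWeight (v - u) dS(v)`, bounded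
uniformly in `u`; Tonelli then integrates the remaining weight in `u`, giving the constant `π^d`
times `∫ |φ|² dS`. -/
theorem IsSpectralMeasure.memLp_entireDensity (hS : IsSpectralMeasure M S)
    (hφ : MemLp φ 2 S) (hκ : ContDiff ℝ 2 κ) (hs : HasCompactSupport κ) :
    MemLp (fun u => entireDensity κ S φ (toComplexSpace u)) 2 volume := by
  have := hS.locallyFinite
  obtain ⟨C, hC, hb⟩ := exists_norm_tensorLaplace_real_le hκ hs d
  obtain ⟨D, hD, hw⟩ := hS.exists_lintegral_cauchyWeight_sub_le
  have hcont : Continuous fun u => entireDensity κ S φ (toComplexSpace u) :=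
    (hS.differentiable_entireDensity hφ hκ hs).continuous.comp continuous_toComplexSpace
  refine ⟨hcont.aestronglyMeasurable, ?_⟩
  rw [eLpNorm_lt_top_iff_lintegral_rpow_enorm_lt_top (by simp) (by simp)]
  simp only [ENNReal.toReal_ofNat, ENNReal.rpow_ofNat]
  set c : ENNReal := ENNReal.ofReal ((2 * Real.pi) ^ d)⁻¹ * ENNReal.ofReal C
  have hpt : ∀ u : EuclideanSpace ℝ (Fin d), ‖entireDensity κ S φ (toComplexSpace u)‖ₑ ^ 2 ≤
      c ^ 2 * ENNReal.ofReal D *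
        ∫⁻ v, ‖φ v‖ₑ ^ 2 * ENNReal.ofReal (cauchyWeight (v - u)) ∂S := by
    intro u
    have h1 : ‖entireDensity κ S φ (toComplexSpace u)‖ₑ ≤
        c * ∫⁻ v, ‖φ v‖ₑ * ENNReal.ofReal (cauchyWeight (v - u)) ∂S := by
      rw [← ofReal_norm, norm_entireDensity, ENNReal.ofReal_mul (by positivity), mul_assoc,
        ofReal_norm]
      gcongr
      exact enorm_integral_tensorLaplace_le hC.le (fun v => hb v u)
    have h2 := lintegral_mul_sq_le (μ := S) (f := fun v => ‖φ v‖ₑ)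
      (w := fun v => ENNReal.ofReal (cauchyWeight (v - u))) hφ.1.enorm
      ((continuous_cauchyWeight.comp (by fun_prop :
        Continuous fun v : EuclideanSpace ℝ (Fin d) => v - u)).measurable.ennreal_ofReal).aemeasurable
    calc _ ≤ (c * ∫⁻ v, ‖φ v‖ₑ * ENNReal.ofReal (cauchyWeight (v - u)) ∂S) ^ 2 :=
          pow_le_pow_left' h1 2
      _ ≤ _ := by
          rw [mul_pow, mul_assoc]
          gcongr
          exact h2.trans (mul_le_mul_left (hw u) _)
  refine (lintegral_mono hpt).trans_lt ?_
  have hcfin : c ^ 2 * ENNReal.ofReal D ≠ ⊤ := by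
    refine ENNReal.mul_ne_top (ENNReal.pow_ne_top (ENNReal.mul_ne_top ?_ ?_)) ?_ <;>
      exact ENNReal.ofReal_ne_top
  rw [lintegral_const_mul' _ _ hcfin]
  refine ENNReal.mul_lt_top hcfin.lt_top ?_
  have hmeas : AEMeasurable (Function.uncurry fun (u v : EuclideanSpace ℝ (Fin d)) =>
      ‖φ v‖ₑ ^ 2 * ENNReal.ofReal (cauchyWeight (v - u))) (volume.prod S) := by
    have h1 : AEMeasurable (fun p : EuclideanSpace ℝ (Fin d) × EuclideanSpace ℝ (Fin d) =>
        ‖φ p.2‖ₑ ^ 2) (volume.prod S) :=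
      (hφ.1.enorm.pow_const 2).comp_quasiMeasurePreserving Measure.quasiMeasurePreserving_snd
    have h2 : Measurable fun p : EuclideanSpace ℝ (Fin d) × EuclideanSpace ℝ (Fin d) =>
        ENNReal.ofReal (cauchyWeight (p.2 - p.1)) :=
      (continuous_cauchyWeight.comp (continuous_snd.sub continuous_fst)).measurable.ennreal_ofReal
    exact h1.mul h2.aemeasurable
  rw [lintegral_lintegral_swap hmeas]
  have : ∀ v : EuclideanSpace ℝ (Fin d),
      ∫⁻ u, ‖φ v‖ₑ ^ 2 * ENNReal.ofReal (cauchyWeight (v - u)) =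
        ‖φ v‖ₑ ^ 2 * ENNReal.ofReal (Real.pi ^ d) := by
    intro v
    rw [lintegral_const_mul' _ _ (ENNReal.pow_ne_top enorm_ne_top), lintegral_cauchyWeight_sub]
  simp_rw [this]
  rw [lintegral_mul_const' _ _ ENNReal.ofReal_ne_top]
  exact ENNReal.mul_lt_top (lintegral_enorm_sq_lt_top hφ) ENNReal.ofReal_lt_top

/-- The central identity. It holds for every test function `h`, with no condition on its support,
because orthogonality absorbs the part of `h` that `χ` removes. -/
theorem IsSpectralMeasure.integral_fourierHat_eq_entireDensity (hS : IsSpectralMeasure M S)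
    (hφ : MemLp φ 2 S) {A U : Set (EuclideanSpace ℝ (Fin d))}
    (hφA : IsOrthogonalOutside S A φ) (hκ : ContDiff ℝ ((⊤ : ℕ∞) : WithTop ℕ∞) κ)
    (hs : HasCompactSupport κ) (hU : IsOpen U) (hAU : A ⊆ U)
    (h1 : ∀ t ∈ U, ∏ j, κ (t j) = 1) {h : EuclideanSpace ℝ (Fin d) → ℂ}
    {V : Set (EuclideanSpace ℝ (Fin d))} (hh : h ∈ testFunctions V) :
    ∫ u, conj (φ u) * fourierHat h u ∂S =
      ∫ u, fourierHat h u * entireDensity κ S φ (toComplexSpace u) := by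
  have := hS.locallyFinite
  have hκ2 : ContDiff ℝ 2 κ := contDiff_infty.1 hκ 2
  set χ : EuclideanSpace ℝ (Fin d) → ℂ := fun t => ∏ j, κ (t j) with hχdef
  have hχ : ContDiff ℝ ((⊤ : ℕ∞) : WithTop ℕ∞) χ := contDiff_tensor hκ
  have hχs : HasCompactSupport χ := hasCompactSupport_prod hs
  have hχi : Integrable χ := hχ.continuous.integrable_of_hasCompactSupport hχs
  have hχh : IsBddCompact fun t => χ t * h t := by
    obtain ⟨C, hC⟩ := hχ.continuous.bounded_above_of_compact_support hχs
    exact (IsBddCompact.of_test hh).bdd_mul hχ.continuous.measurable hC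
  have hd := one_sub_mul_mem_testFunctions hχ hU hAU h1 hh
  have hconj : MemLp (fun u => conj (φ u)) 2 S := hφ.star
  have hsplit : ∀ u, fourierHat h u = fourierHat (fun t => χ t * h t) u +
      fourierHat (fun t => h t - χ t * h t) u := by
    intro u
    rw [← fourierHat_add hχh.integrable (IsBddCompact.of_test hd).integrable]
    congr 1
    ext t
    ring
  -- `h - χ h` vanishes on the neighbourhood `U` of `A`, so its contribution is zero by
  -- orthogonality.
  have e1 : ∫ u, conj (φ u) * fourierHat h u ∂S =
      ∫ u, conj (φ u) * fourierHat (fun t => χ t * h t) u ∂S := by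
    simp_rw [hsplit, mul_add]
    rw [integral_add, hφA _ hd, add_zero]
    · exact hconj.integrable_mul (hS.memLp_fourierHat hχh)
    · exact hconj.integrable_mul (hS.memLp_fourierHat (IsBddCompact.of_test hd))
  have hk : ∀ u v : EuclideanSpace ℝ (Fin d), fourierHat χ (v - u) =
      tensorLaplace κ (toComplexSpace v - toComplexSpace u) := by
    intro u v
    rw [hχdef, ← tensorLaplace_eq_fourierHat]
    congr 1
    ext j
    simp [toComplexSpace]
  rw [e1]
  simp_rw [fourierHat_mul_eq hχi hh, entireDensity]
  have e2 : ∫ v, conj (φ v) * ((((2 * Real.pi) ^ d)⁻¹ : ℝ) *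
      ∫ u, fourierHat h u * fourierHat χ (v - u)) ∂S = (((2 * Real.pi) ^ d)⁻¹ : ℝ) *
        ∫ v, (∫ u, fourierHat h u * (tensorLaplace κ (toComplexSpace v - toComplexSpace u) *
          conj (φ v))) ∂S := by
    rw [← integral_const_mul]
    congr 1
    ext v
    rw [mul_left_comm, ← integral_const_mul]
    congr 2
    ext u
    rw [hk]
    ring
  rw [e2, integral_integral_swap]
  · rw [← integral_const_mul]
    congr 1
    ext u
    rw [integral_const_mul]
    ring
  -- Fubini is justified by integrating in `v` first: the result is at most `C * B` times `|ĥ(u)|`,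
  -- and `ĥ` is Lebesgue integrable.
  · obtain ⟨C, hC, hb⟩ := exists_norm_tensorLaplace_real_le hκ2 hs d
    obtain ⟨B, hB0, hB⟩ := hS.exists_lintegral_mul_cauchyWeight_le hφ
    have hhi := integrable_fourierHat hh
    have hmeas : AEStronglyMeasurable (Function.uncurry fun v u : EuclideanSpace ℝ (Fin d) =>
        fourierHat h u * (tensorLaplace κ (toComplexSpace v - toComplexSpace u) * conj (φ v)))
        (S.prod volume) := by
      refine AEStronglyMeasurable.mul ?_ (AEStronglyMeasurable.mul ?_ ?_)
      · exact ((continuous_fourierHat (IsBddCompact.of_test hh).integrable).comp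
          continuous_snd).aestronglyMeasurable
      · exact ((differentiable_tensorLaplace hκ2.continuous hs).continuous.comp
          ((continuous_toComplexSpace.comp continuous_fst).sub
            (continuous_toComplexSpace.comp continuous_snd))).aestronglyMeasurable
      · exact hconj.1.comp_quasiMeasurePreserving Measure.quasiMeasurePreserving_fst
    refine ⟨hmeas, ?_⟩
    rw [hasFiniteIntegral_iff_enorm, lintegral_prod_symm _ hmeas.enorm]
    have hpt : ∀ u, ∫⁻ v, ‖fourierHat h u * (tensorLaplace κ
        (toComplexSpace v - toComplexSpace u) * conj (φ v))‖ₑ ∂S ≤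
          ‖fourierHat h u‖ₑ * (ENNReal.ofReal C * ENNReal.ofReal B) := by
      intro u
      simp_rw [enorm_mul (fourierHat h u)]
      rw [lintegral_const_mul' _ _ enorm_ne_top]
      gcongr
      refine le_trans ?_ (mul_le_mul_right (hB u) _)
      rw [← lintegral_const_mul' _ _ ENNReal.ofReal_ne_top]
      refine lintegral_mono fun v => ?_
      rw [enorm_mul, RCLike.enorm_conj, mul_comm, mul_left_comm, ← ENNReal.ofReal_mul hC.le]
      gcongr
      rw [← ofReal_norm]
      exact ENNReal.ofReal_le_ofReal (hb v u)
    refine (lintegral_mono hpt).trans_lt ?_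
    rw [lintegral_mul_const' _ _ (ENNReal.mul_ne_top ENNReal.ofReal_ne_top ENNReal.ofReal_ne_top)]
    exact ENNReal.mul_lt_top hhi.2 (ENNReal.mul_lt_top ENNReal.ofReal_lt_top ENNReal.ofReal_lt_top)

end Spectral

/-! ### Uniqueness of Fourier transforms, relative to a general measure -/

section Uniqueness

variable {d : ℕ} {μ : Measure (EuclideanSpace ℝ (Fin d))}

/-- The positive and negative parts of `g` are densities of two finite measures with equal
characteristic functions, hence the measures, and then the densities, agree. -/
theorem ae_eq_zero_of_integral_exp_mul_ofReal {g : EuclideanSpace ℝ (Fin d) → ℝ}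
    (hg : Integrable g μ)
    (h : ∀ a : EuclideanSpace ℝ (Fin d),
      ∫ u, Complex.exp (-(Complex.I * ((inner ℝ a u : ℝ) : ℂ))) * (g u : ℂ) ∂μ = 0) :
    g =ᵐ[μ] 0 := by
  have hfin : ∀ {g : EuclideanSpace ℝ (Fin d) → ℝ}, Integrable g μ →
      ∫⁻ u, ENNReal.ofReal (g u) ∂μ ≠ ⊤ := fun hg => hg.lintegral_lt_top.ne
  have : IsFiniteMeasure (μ.withDensity fun u => ENNReal.ofReal (g u)) :=
    isFiniteMeasure_withDensity (hfin hg)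
  have : IsFiniteMeasure (μ.withDensity fun u => ENNReal.ofReal (-g u)) :=
    isFiniteMeasure_withDensity (hfin hg.neg)
  have hc : ∀ {g : EuclideanSpace ℝ (Fin d) → ℝ}, Integrable g μ → ∀ t,
      charFun (μ.withDensity fun u => ENNReal.ofReal (g u)) t =
        ∫ u, Complex.exp ((inner ℝ u t : ℝ) * Complex.I) * ((max (g u) 0 : ℝ) : ℂ) ∂μ := by
    intro g hg t
    rw [charFun_apply, integral_withDensity_eq_integral_toReal_smul₀
      hg.1.aemeasurable.ennreal_ofReal (Filter.Eventually.of_forall fun _ => ENNReal.ofReal_lt_top)]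
    congr 1
    ext u
    rw [ENNReal.toReal_ofReal', Complex.real_smul, mul_comm]
  have hi : ∀ {g : EuclideanSpace ℝ (Fin d) → ℝ}, Integrable g μ → ∀ t : EuclideanSpace ℝ (Fin d),
      Integrable (fun u => Complex.exp ((inner ℝ u t : ℝ) * Complex.I) *
        ((max (g u) 0 : ℝ) : ℂ)) μ := by
    intro g hg t
    have h1 : Integrable (fun u => ((max (g u) 0 : ℝ) : ℂ)) μ := hg.pos_part.ofReal
    refine h1.norm.mono' (Continuous.aestronglyMeasurable (by fun_prop) |>.mul h1.1)
      (Filter.Eventually.of_forall fun u => ?_)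
    rw [norm_mul, Complex.norm_exp_ofReal_mul_I, one_mul]
  have heq : (μ.withDensity fun u => ENNReal.ofReal (g u)) =
      μ.withDensity fun u => ENNReal.ofReal (-g u) := by
    refine Measure.ext_of_charFun (funext fun t => ?_)
    rw [hc hg, hc (g := fun u => -g u) hg.neg, ← sub_eq_zero,
      ← integral_sub (hi hg t) (hi (g := fun u => -g u) hg.neg t), ← h (-t)]
    congr 1
    ext u
    rw [← mul_sub, ← Complex.ofReal_sub]
    congr 2
    · rw [inner_neg_left, real_inner_comm]
      push_cast
      ring
    · rcases le_total (g u) 0 with h0 | h0 <;> simp [h0]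
  have hae := (withDensity_eq_iff (g := fun u => ENNReal.ofReal (-g u))
    hg.1.aemeasurable.ennreal_ofReal hg.1.aemeasurable.neg.ennreal_ofReal (hfin hg)).1 heq
  filter_upwards [hae] with u hu
  rcases le_total (g u) 0 with h0 | h0
  · rw [ENNReal.ofReal_of_nonpos h0, eq_comm, ENNReal.ofReal_eq_zero] at hu
    simp only [Pi.zero_apply]
    linarith
  · rw [ENNReal.ofReal_of_nonpos (neg_nonpos.2 h0), ENNReal.ofReal_eq_zero] at hu
    simp only [Pi.zero_apply]
    linarith

theorem ae_eq_zero_of_integral_exp_mul {G : EuclideanSpace ℝ (Fin d) → ℂ} (hG : Integrable G μ)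
    (h : ∀ a : EuclideanSpace ℝ (Fin d),
      ∫ u, Complex.exp (-(Complex.I * ((inner ℝ a u : ℝ) : ℂ))) * G u ∂μ = 0) :
    G =ᵐ[μ] 0 := by
  have hconj : ∀ a : EuclideanSpace ℝ (Fin d),
      ∫ u, Complex.exp (-(Complex.I * ((inner ℝ a u : ℝ) : ℂ))) * conj (G u) ∂μ = 0 := by
    intro a
    rw [← map_zero (starRingEnd ℂ), ← h (-a), ← integral_conj]
    congr 1
    ext u
    rw [map_mul, ← Complex.exp_conj]
    simp
  have hexp : ∀ (a : EuclideanSpace ℝ (Fin d)) {F : EuclideanSpace ℝ (Fin d) → ℂ},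
      Integrable F μ →
      Integrable (fun u => Complex.exp (-(Complex.I * ((inner ℝ a u : ℝ) : ℂ))) * F u) μ := by
    intro a F hF
    refine hF.norm.mono' (Continuous.aestronglyMeasurable (by fun_prop) |>.mul hF.1)
      (Filter.Eventually.of_forall fun t => ?_)
    rw [norm_mul, norm_exp_neg_I_mul_real, one_mul]
  have hGc : Integrable (fun u => conj (G u)) μ := by
    simpa using (LinearIsometryEquiv.integrable_comp_iff Complex.conjLIE).2 hG
  have hre : (fun u => (G u).re) =ᵐ[μ] 0 := by
    refine ae_eq_zero_of_integral_exp_mul_ofReal hG.re fun a => ?_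
    have : ∀ u, Complex.exp (-(Complex.I * ((inner ℝ a u : ℝ) : ℂ))) * ((G u).re : ℂ) =
        (1 / 2 : ℂ) * (Complex.exp (-(Complex.I * ((inner ℝ a u : ℝ) : ℂ))) * G u +
          Complex.exp (-(Complex.I * ((inner ℝ a u : ℝ) : ℂ))) * conj (G u)) := by
      intro u
      rw [← mul_add, Complex.add_conj]
      push_cast
      ring
    simp_rw [this]
    rw [integral_const_mul, integral_add (hexp a hG) (hexp a hGc), h, hconj]
    simp
  have him : (fun u => (G u).im) =ᵐ[μ] 0 := by
    refine ae_eq_zero_of_integral_exp_mul_ofReal hG.im fun a => ?_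
    have : ∀ u, Complex.exp (-(Complex.I * ((inner ℝ a u : ℝ) : ℂ))) * ((G u).im : ℂ) =
        (1 / (2 * Complex.I) : ℂ) * (Complex.exp (-(Complex.I * ((inner ℝ a u : ℝ) : ℂ))) * G u -
          Complex.exp (-(Complex.I * ((inner ℝ a u : ℝ) : ℂ))) * conj (G u)) := by
      intro u
      rw [← mul_sub, Complex.sub_conj]
      field_simp
      push_cast
      ring
    simp_rw [this]
    rw [integral_const_mul, integral_sub (hexp a hG) (hexp a hGc), h, hconj]
    simp
  filter_upwards [hre, him] with u h1 h2
  exact Complex.ext h1 h2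

theorem fourierHat_comp_sub (h : EuclideanSpace ℝ (Fin d) → ℂ) (a u : EuclideanSpace ℝ (Fin d)) :
    fourierHat (fun t => h (t - a)) u =
      Complex.exp (-(Complex.I * ((inner ℝ a u : ℝ) : ℂ))) * fourierHat h u := by
  rw [fourierHat_def, ← integral_add_right_eq_self _ a, fourierHat_def, ← integral_const_mul]
  congr 1
  ext t
  rw [add_sub_cancel_right, ← mul_assoc, ← Complex.exp_add, inner_add_right,
    real_inner_comm u a]
  congr 2
  push_cast
  ring

theorem comp_sub_mem_testFunctions {h : EuclideanSpace ℝ (Fin d) → ℂ}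
    (hh : h ∈ testFunctions Set.univ) (a : EuclideanSpace ℝ (Fin d)) :
    (fun t => h (t - a)) ∈ testFunctions (Set.univ : Set (EuclideanSpace ℝ (Fin d))) := by
  refine ⟨hh.1.comp (contDiff_id.sub contDiff_const), ?_, Set.subset_univ _⟩
  exact hh.2.1.comp_homeomorph (Homeomorph.subRight a)

/-- For a bump `b` of radius `1 / (n + 1)`, `b̂(u)` differs from `∫ b` by at most `‖u‖ / (n + 1)`
times `∫ b`, so it is nonzero once `n > ‖u‖`. -/
theorem exists_testFunctions_fourierHat_ne_zero (d : ℕ) :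
    ∃ h : ℕ → EuclideanSpace ℝ (Fin d) → ℂ, (∀ n, h n ∈ testFunctions Set.univ) ∧
      ∀ u, ∃ n, fourierHat (h n) u ≠ 0 := by
  have hpos : ∀ n : ℕ, (0 : ℝ) < 1 / (n + 1) := fun n => Nat.one_div_pos_of_nat
  let b : ℕ → ContDiffBump (0 : EuclideanSpace ℝ (Fin d)) := fun n =>
    ⟨1 / (n + 1) / 2, 1 / (n + 1), half_pos (hpos n), half_lt_self (hpos n)⟩
  refine ⟨fun n t => (b n t : ℂ), fun n => ⟨Complex.ofRealCLM.contDiff.comp (b n).contDiff,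
    (b n).hasCompactSupport.comp_left Complex.ofReal_zero, Set.subset_univ _⟩, fun u => ?_⟩
  obtain ⟨n, hn⟩ := exists_nat_gt ‖u‖
  refine ⟨n, fun h0 => ?_⟩
  have hint : Integrable (fun t => (b n t : ℂ)) := (b n).integrable.ofReal
  have hIpos : 0 < ∫ t, b n t := (b n).integral_pos
  have hle : ‖fourierHat (fun t => (b n t : ℂ)) u - ∫ t, (b n t : ℂ)‖ ≤
      ∫ t, ‖u‖ / (n + 1) * b n t := by
    rw [fourierHat_def, ← integral_sub (integrable_exp_mul hint u) hint]
    refine norm_integral_le_of_norm_le ((b n).integrable.const_mul _)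
      (Filter.Eventually.of_forall fun t => ?_)
    rw [← sub_one_mul, norm_mul, Complex.norm_real, Real.norm_of_nonneg (b n).nonneg]
    by_cases ht : t ∈ Metric.ball (0 : EuclideanSpace ℝ (Fin d)) (1 / (n + 1))
    · refine mul_le_mul_of_nonneg_right ?_ (b n).nonneg
      rw [mem_ball_zero_iff] at ht
      have h1 := Real.norm_exp_I_mul_ofReal_sub_one_le (x := -inner ℝ u t)
      rw [Complex.ofReal_neg, mul_neg] at h1
      refine h1.trans ?_
      rw [norm_neg]
      refine (norm_inner_le_norm u t).trans ?_
      rw [div_eq_mul_one_div]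
      exact mul_le_mul_of_nonneg_left ht.le (norm_nonneg _)
    · have : b n t = 0 := (b n).zero_of_le_dist (not_lt.1 ht)
      simp [this]
  rw [h0, zero_sub, norm_neg, integral_complex_ofReal, Complex.norm_real,
    Real.norm_of_nonneg hIpos.le, integral_const_mul] at hle
  have : ‖u‖ / (n + 1) < 1 := by
    rw [div_lt_one (by positivity)]
    linarith
  nlinarith

/-- Translates of a test function are test functions, so the integrable function `ĥ G` has vanishing
Fourier transform and is zero almost everywhere. Countably many `ĥ` without a common zero then force
`G = 0`; integrability of `G` itself is not needed. -/
theorem ae_eq_zero_of_integral_fourierHat_mul {G : EuclideanSpace ℝ (Fin d) → ℂ}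
    (hi : ∀ h ∈ testFunctions (Set.univ : Set (EuclideanSpace ℝ (Fin d))),
      Integrable (fun u => fourierHat h u * G u) μ)
    (h0 : ∀ h ∈ testFunctions (Set.univ : Set (EuclideanSpace ℝ (Fin d))),
      ∫ u, fourierHat h u * G u ∂μ = 0) : G =ᵐ[μ] 0 := by
  obtain ⟨h, hh, hne⟩ := exists_testFunctions_fourierHat_ne_zero d
  have : ∀ n, (fun u => fourierHat (h n) u * G u) =ᵐ[μ] 0 := by
    intro n
    refine ae_eq_zero_of_integral_exp_mul (hi _ (hh n)) fun a => ?_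
    rw [← h0 _ (comp_sub_mem_testFunctions (hh n) a)]
    congr 1
    ext u
    rw [fourierHat_comp_sub]
    ring
  filter_upwards [ae_all_iff.2 this] with u hu
  obtain ⟨n, hn⟩ := hne u
  exact (mul_eq_zero.1 (hu n)).resolve_left hn

theorem ae_eq_of_integral_fourierHat_eq {S : Measure (EuclideanSpace ℝ (Fin d))} [SigmaFinite S]
    {φ ψ : EuclideanSpace ℝ (Fin d) → ℂ}
    (hφi : ∀ h ∈ testFunctions (Set.univ : Set (EuclideanSpace ℝ (Fin d))),
      Integrable (fun u => fourierHat h u * φ u) S)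
    (hψi : ∀ h ∈ testFunctions (Set.univ : Set (EuclideanSpace ℝ (Fin d))),
      Integrable (fun u => fourierHat h u * ψ u))
    (heq : ∀ h ∈ testFunctions (Set.univ : Set (EuclideanSpace ℝ (Fin d))),
      ∫ u, fourierHat h u * φ u ∂S = ∫ u, fourierHat h u * ψ u) :
    (∀ᵐ u, (spectralDensity S u).toReal * φ u = ψ u) ∧
      ∀ᵐ u ∂(S.singularPart volume), φ u = 0 := by
  classical
  obtain ⟨N, hN, hN1, hN2⟩ := S.mutuallySingular_singularPart volume
  set T := S.singularPart volume
  set s := spectralDensity S with hs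
  have hsm : Measurable s := Measure.measurable_rnDeriv _ _
  have hsfin : ∀ᵐ u, s u < ⊤ := Measure.rnDeriv_lt_top _ _
  have hST : S = T + volume.withDensity s := Measure.haveLebesgueDecomposition_add S volume
  -- `N` carries Lebesgue measure and is null for the singular part `T`, so one function on `T +
  -- volume` encodes both claims: it is `s φ - ψ` for Lebesgue measure and `φ` for `T`.
  set G : EuclideanSpace ℝ (Fin d) → ℂ :=
    fun u => if u ∈ N then (s u).toReal * φ u - ψ u else φ u
  have hTN : ∀ᵐ u ∂T, u ∉ N := measure_eq_zero_iff_ae_notMem.1 hN1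
  have hvN : ∀ᵐ u ∂(volume : Measure (EuclideanSpace ℝ (Fin d))), u ∈ N := by
    rw [ae_iff]
    exact hN2
  have hGT : ∀ᵐ u ∂T, G u = φ u := hTN.mono fun u hu => if_neg hu
  have hGv : ∀ᵐ u, G u = (s u).toReal * φ u - ψ u := hvN.mono fun u hu => if_pos hu
  have hparts : ∀ h ∈ testFunctions (Set.univ : Set (EuclideanSpace ℝ (Fin d))),
      Integrable (fun u => fourierHat h u * φ u) T ∧
      Integrable (fun u => (s u).toReal • (fourierHat h u * φ u)) := by
    intro h hh
    have := hφi h hh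
    rw [hST, integrable_add_measure] at this
    exact ⟨this.1, (integrable_withDensity_iff_integrable_smul' hsm hsfin).1 this.2⟩
  have hGTm : ∀ h, (fun u => fourierHat h u * G u) =ᵐ[T] fun u => fourierHat h u * φ u :=
    fun h => hGT.mono fun u hu => by simp only [hu]
  have hGvm : ∀ h, (fun u => fourierHat h u * G u) =ᵐ[volume] fun u =>
      (s u).toReal • (fourierHat h u * φ u) - fourierHat h u * ψ u :=
    fun h => hGv.mono fun u hu => by
      simp only [hu, Complex.real_smul]
      ring
  have hG : G =ᵐ[T + volume] 0 := by
    refine ae_eq_zero_of_integral_fourierHat_mul (fun h hh => ?_) fun h hh => ?_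
    · rw [integrable_add_measure]
      exact ⟨(hparts h hh).1.congr (hGTm h).symm,
        ((hparts h hh).2.sub (hψi h hh)).congr (hGvm h).symm⟩
    · rw [integral_add_measure ((hparts h hh).1.congr (hGTm h).symm)
        (((hparts h hh).2.sub (hψi h hh)).congr (hGvm h).symm),
        integral_congr_ae (hGTm h), integral_congr_ae (hGvm h),
        integral_sub (hparts h hh).2 (hψi h hh), ← heq h hh]
      have h3 : ∫ u, fourierHat h u * φ u ∂S = ∫ u, fourierHat h u * φ u ∂T +
          ∫ u, (s u).toReal • (fourierHat h u * φ u) := by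
        rw [← integral_withDensity_eq_integral_toReal_smul hsm hsfin, ← integral_add_measure
          (hparts h hh).1 ((integrable_withDensity_iff_integrable_smul' hsm hsfin).2
            (hparts h hh).2), ← hST]
      rw [h3]
      ring
  rw [Filter.EventuallyEq, ae_add_measure_iff] at hG
  refine ⟨?_, ?_⟩
  · filter_upwards [hG.2, hGv] with u h1 h2
    rw [h2] at h1
    exact sub_eq_zero.1 h1
  · filter_upwards [hG.1, hGT] with u h1 h2
    rw [← h2, h1]
    rfl

end Uniqueness

/-! ### Dividing by the spectral density -/

section Density

variable {d : ℕ} {S : Measure (EuclideanSpace ℝ (Fin d))} {φ ψ : EuclideanSpace ℝ (Fin d) → ℂ}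

theorem measurable_spectralDensity (S : Measure (EuclideanSpace ℝ (Fin d))) :
    Measurable (spectralDensity S) := Measure.measurable_rnDeriv _ _

theorem spectralDensity_lt_top (S : Measure (EuclideanSpace ℝ (Fin d))) [SigmaFinite S] :
    ∀ᵐ u, spectralDensity S u < ⊤ := Measure.rnDeriv_lt_top _ _

theorem IsEntireExpType.continuous (hψ : IsEntireExpType ψ) : Continuous ψ := by
  obtain ⟨F, hF, -, h⟩ := hψ
  rw [show ψ = fun u => F (toComplexSpace u) from funext h]
  exact hF.continuous.comp continuous_toComplexSpace

/-- The convention `1/0 = ∞` makes the integrand infinite wherever `s = 0` and `ψ ≠ 0`, so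
finiteness of the integral leaves only a null set of such points. -/
theorem SqIntegrableInv.ae_eq_zero (hψ : SqIntegrableInv (spectralDensity S) ψ)
    (hc : Continuous ψ) : ∀ᵐ u, spectralDensity S u = 0 → ψ u = 0 := by
  have hm : Measurable fun u => ‖ψ u‖ₑ ^ 2 * (spectralDensity S u)⁻¹ :=
    (hc.measurable.enorm.pow_const 2).mul (measurable_spectralDensity S).inv
  filter_upwards [ae_lt_top hm hψ.ne] with u hu h0
  by_contra hne
  rw [h0, ENNReal.inv_zero, ENNReal.mul_top (by simpa using hne)] at hu
  exact lt_irrefl _ hu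

theorem IsDivDensity.ae_mul_eq [SigmaFinite S]
    (h : IsDivDensity S φ fun u => conj (ψ u)) (hψ : SqIntegrableInv (spectralDensity S) ψ)
    (hc : Continuous ψ) : ∀ᵐ u, (spectralDensity S u).toReal * conj (φ u) = ψ u := by
  have h1 := (ae_withDensity_iff (measurable_spectralDensity S)).1 h.1
  filter_upwards [h1, hψ.ae_eq_zero hc, spectralDensity_lt_top S] with u h1 h0 hfin
  by_cases hs : spectralDensity S u = 0
  · simp [hs, h0 hs]
  · have hne : ((spectralDensity S u).toReal : ℂ) ≠ 0 :=
      Complex.ofReal_ne_zero.2 (ENNReal.toReal_ne_zero.2 ⟨hs, hfin.ne⟩)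
    rw [h1 hs, map_div₀, Complex.conj_conj, Complex.conj_ofReal, mul_div_cancel₀ _ hne]

theorem integral_mul_conj_eq [SigmaFinite S]
    (hac : ∀ᵐ u, (spectralDensity S u).toReal * conj (φ u) = ψ u)
    (hsing : ∀ᵐ u ∂(S.singularPart volume), φ u = 0) {F : EuclideanSpace ℝ (Fin d) → ℂ}
    (hF : Integrable (fun u => conj (φ u) * F u) S) :
    ∫ u, conj (φ u) * F u ∂S = ∫ u, F u * ψ u := by
  have hST := (Measure.haveLebesgueDecomposition_add S volume)
  have hsum := hF
  rw [hST, integrable_add_measure] at hsum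
  conv_lhs => rw [hST]
  rw [integral_add_measure hsum.1 hsum.2]
  have h0 : ∫ u, conj (φ u) * F u ∂(S.singularPart volume) = 0 := by
    rw [integral_eq_zero_of_ae]
    filter_upwards [hsing] with u hu
    simp [hu]
  rw [h0, zero_add]
  change ∫ u, conj (φ u) * F u ∂(volume.withDensity (spectralDensity S)) = _
  rw [integral_withDensity_eq_integral_toReal_smul (measurable_spectralDensity S)
    (spectralDensity_lt_top S)]
  refine integral_congr_ae ?_
  filter_upwards [hac] with u hu
  rw [← hu, Complex.real_smul]
  ring

theorem isDivDensity_of_ae [SigmaFinite S]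
    (hac : ∀ᵐ u, (spectralDensity S u).toReal * conj (φ u) = ψ u)
    (hsing : ∀ᵐ u ∂(S.singularPart volume), φ u = 0) :
    IsDivDensity S φ fun u => conj (ψ u) := by
  refine ⟨(ae_withDensity_iff (measurable_spectralDensity S)).2 ?_, hsing⟩
  filter_upwards [hac, spectralDensity_lt_top S] with u hu hfin hs
  have hne : ((spectralDensity S u).toReal : ℂ) ≠ 0 :=
    Complex.ofReal_ne_zero.2 (ENNReal.toReal_ne_zero.2 ⟨hs, hfin.ne⟩)
  rw [← hu, map_mul, Complex.conj_conj, Complex.conj_ofReal, mul_div_cancel_left₀ _ hne]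

theorem enorm_sq_mul_inv_le {s : ENNReal} (hs : s < ⊤) (z : ℂ) :
    ‖(s.toReal : ℂ) * z‖ₑ ^ 2 * s⁻¹ ≤ s * ‖z‖ₑ ^ 2 := by
  by_cases h0 : s = 0
  · simp [h0]
  · have : ‖(s.toReal : ℂ)‖ₑ = s := by
      rw [← ofReal_norm, Complex.norm_real, Real.norm_of_nonneg ENNReal.toReal_nonneg,
        ENNReal.ofReal_toReal hs.ne]
    rw [enorm_mul, this, mul_pow, sq s, mul_right_comm, mul_assoc s s, ENNReal.mul_inv_cancel h0 hs.ne, mul_one]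

theorem sqIntegrableInv_of_ae [SigmaFinite S] (hφ : MemLp φ 2 S)
    (hac : ∀ᵐ u, (spectralDensity S u).toReal * conj (φ u) = ψ u) :
    SqIntegrableInv (spectralDensity S) ψ := by
  have hle : volume.withDensity (spectralDensity S) ≤ S := Measure.withDensity_rnDeriv_le S volume
  have h1 : ∫⁻ u, ‖φ u‖ₑ ^ 2 ∂(volume.withDensity (spectralDensity S)) < ⊤ :=
    (lintegral_mono' hle le_rfl).trans_lt (lintegral_enorm_sq_lt_top hφ)
  rw [lintegral_withDensity_eq_lintegral_mul₀' (measurable_spectralDensity S).aemeasurable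
    ((hφ.1.enorm.pow_const 2).mono_measure hle)] at h1
  refine lt_of_le_of_lt (lintegral_mono_ae ?_) h1
  filter_upwards [hac, spectralDensity_lt_top S] with u hu hfin
  rw [← hu]
  refine (enorm_sq_mul_inv_le hfin _).trans (le_of_eq ?_)
  rw [RCLike.enorm_conj]
  rfl

theorem exists_isDivDensity [SigmaFinite S] (hc : Continuous ψ)
    (hψ : SqIntegrableInv (spectralDensity S) ψ) :
    ∃ φ, MemLp φ 2 S ∧ IsDivDensity S φ fun u => conj (ψ u) := by
  classical
  obtain ⟨N, hN, hN1, hN2⟩ := S.mutuallySingular_singularPart volume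
  set s := spectralDensity S with hs
  have hsm : Measurable s := measurable_spectralDensity S
  set φ₀ : EuclideanSpace ℝ (Fin d) → ℂ := fun u => conj (ψ u) / ((s u).toReal : ℂ)
  have hφm : Measurable φ₀ :=
    (Complex.continuous_conj.comp hc).measurable.div hsm.ennreal_toReal.complex_ofReal
  have hTN : ∀ᵐ u ∂(S.singularPart volume), N.indicator φ₀ u = 0 :=
    (measure_eq_zero_iff_ae_notMem.1 hN1).mono fun u hu => Set.indicator_of_notMem hu _
  have hvN : ∀ᵐ u ∂(volume : Measure (EuclideanSpace ℝ (Fin d))), N.indicator φ₀ u = φ₀ u := by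
    have : ∀ᵐ u ∂(volume : Measure (EuclideanSpace ℝ (Fin d))), u ∈ N := by
      rw [ae_iff]
      exact hN2
    exact this.mono fun u hu => Set.indicator_of_mem hu _
  -- Cutting off to `N` kills the singular part without changing `φ₀` Lebesgue-almost everywhere.
  -- Where `s = 0` the value of the quotient is immaterial, since the density weights it by 0.
  refine ⟨N.indicator φ₀, ⟨(hφm.indicator hN).aestronglyMeasurable, ?_⟩,
    (withDensity_absolutelyContinuous _ _) hvN, hTN⟩
  rw [eLpNorm_lt_top_iff_lintegral_rpow_enorm_lt_top (by simp) (by simp)]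
  simp only [ENNReal.toReal_ofNat, ENNReal.rpow_ofNat]
  have hST := (Measure.haveLebesgueDecomposition_add S volume)
  rw [hST, lintegral_add_measure]
  have h0 : ∫⁻ u, ‖N.indicator φ₀ u‖ₑ ^ 2 ∂(S.singularPart volume) = 0 := by
    rw [lintegral_eq_zero_iff ((hφm.indicator hN).enorm.pow_const 2)]
    filter_upwards [hTN] with u hu
    simp [hu]
  rw [h0, zero_add]
  change ∫⁻ u, ‖N.indicator φ₀ u‖ₑ ^ 2 ∂(volume.withDensity s) < ⊤
  rw [lintegral_withDensity_eq_lintegral_mul _ hsm ((hφm.indicator hN).enorm.pow_const 2)]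
  refine lt_of_le_of_lt (lintegral_mono_ae ?_) hψ
  filter_upwards [hvN, spectralDensity_lt_top S] with u hu hfin
  simp only [Pi.mul_apply, hu]
  by_cases hs0 : s u = 0
  · simp [hs0]
  · have hn : ‖((s u).toReal : ℂ)‖ₑ = s u := by
      rw [← ofReal_norm, Complex.norm_real, Real.norm_of_nonneg ENNReal.toReal_nonneg,
        ENNReal.ofReal_toReal hfin.ne]
    have hne : ((s u).toReal : ℂ) ≠ 0 :=
      Complex.ofReal_ne_zero.2 (ENNReal.toReal_ne_zero.2 ⟨hs0, hfin.ne⟩)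
    have hψu : ‖ψ u‖ₑ = s u * ‖φ₀ u‖ₑ := by
      rw [← RCLike.enorm_conj (ψ u), ← hn, ← enorm_mul, mul_div_cancel₀ _ hne]
    rw [hψu, mul_pow, sq (s u), mul_right_comm, mul_assoc (s u) (s u),
      ENNReal.mul_inv_cancel hs0 hfin.ne, mul_one]

end Density

/-! ### The orthogonal complement -/

section Representation

variable {Ω : Type*} [MeasurableSpace Ω] {P : Measure Ω} {d : ℕ}
  {M : StatRandomMeasure P d} {S : Measure (EuclideanSpace ℝ (Fin d))}
  {φ ψ : EuclideanSpace ℝ (Fin d) → ℂ} {A : Set (EuclideanSpace ℝ (Fin d))}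

theorem IsSpectralMeasure.exists_mem_expTypeClass (hS : IsSpectralMeasure M S) (hA : IsCompact A)
    (hφ : MemLp φ 2 S) (hφA : IsOrthogonalOutside S A φ) :
    ∃ ψ ∈ expTypeClass A, MemLp ψ 2 volume ∧
      (∀ᵐ u, (spectralDensity S u).toReal * conj (φ u) = ψ u) ∧
      ∀ᵐ u ∂(S.singularPart volume), φ u = 0 := by
  have := hS.locallyFinite
  obtain ⟨κ, hκ, hs, U, hU, hAU, h1⟩ := exists_tensor_cutoff hA
  have hκ2 : ContDiff ℝ 2 κ := contDiff_infty.1 hκ 2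
  set ψ : EuclideanSpace ℝ (Fin d) → ℂ := fun u => entireDensity κ S φ (toComplexSpace u)
  have hent : IsEntireExpType ψ := hS.isEntireExpType_entireDensity hφ hκ2 hs
  obtain ⟨C, hC⟩ : ∃ C : ℝ, ∀ u, ‖ψ u‖ ≤ C := by
    obtain ⟨C, R, -, -, h⟩ := hS.exists_norm_entireDensity_le hφ hκ2 hs
    refine ⟨C, fun u => (h _).trans (le_of_eq ?_)⟩
    simp [toComplexSpace]
  have hrep : ∀ {V : Set (EuclideanSpace ℝ (Fin d))}, ∀ h ∈ testFunctions V,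
      ∫ u, conj (φ u) * fourierHat h u ∂S = ∫ u, fourierHat h u * ψ u := fun h hh =>
    hS.integral_fourierHat_eq_entireDensity hφ hφA hκ hs hU hAU h1 hh
  have hconj : MemLp (fun u => conj (φ u)) 2 S := hφ.star
  have hae := ae_eq_of_integral_fourierHat_eq (S := S) (φ := fun u => conj (φ u)) (ψ := ψ)
    (fun h hh => (hS.memLp_fourierHat (IsBddCompact.of_test hh)).integrable_mul hconj)
    (fun h hh => (integrable_fourierHat hh).mul_bdd (c := C)
      hent.continuous.aestronglyMeasurable (Filter.Eventually.of_forall hC))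
    (fun h hh => by
      rw [← hrep h hh]
      congr 1
      ext u
      ring)
  refine ⟨ψ, ⟨hent, ⟨C, 0, fun u => by simpa using hC u⟩, fun h hh => ?_⟩,
    hS.memLp_entireDensity hφ hκ2 hs, hae.1, hae.2.mono fun u hu => by simpa using hu⟩
  rw [← hrep h hh]
  exact hφA h hh

theorem IsSpectralMeasure.isOrthogonalOutside_of_isDivDensity (hS : IsSpectralMeasure M S)
    (hφ : MemLp φ 2 S) (hψ : ψ ∈ expTypeClass A) (hψ2 : SqIntegrableInv (spectralDensity S) ψ)
    (h : IsDivDensity S φ fun u => conj (ψ u)) : IsOrthogonalOutside S A φ := by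
  have := hS.locallyFinite
  intro f hf
  have hconj : MemLp (fun u => conj (φ u)) 2 S := hφ.star
  rw [integral_mul_conj_eq (h.ae_mul_eq hψ2 hψ.1.continuous) h.2
    (hconj.integrable_mul (hS.memLp_fourierHat (IsBddCompact.of_test hf)))]
  exact hψ.2.2 f hf

/-- A detour through `L²(S)`: `conj ψ / s` is orthogonal to the admissible transforms, so its entire
density lies in `L²(du)`; that density equals `s` times the conjugate of the quotient, which is `ψ`
almost everywhere. -/
theorem IsSpectralMeasure.memLp_of_sqIntegrableInv (hS : IsSpectralMeasure M S)
    (hA : IsCompact A) (hψ : ψ ∈ expTypeClass A)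
    (hψ2 : SqIntegrableInv (spectralDensity S) ψ) : MemLp ψ 2 volume := by
  have := hS.locallyFinite
  obtain ⟨φ, hφ, hdiv⟩ := exists_isDivDensity hψ.1.continuous hψ2
  obtain ⟨ψ', -, hL, hae, -⟩ := hS.exists_mem_expTypeClass hA hφ
    (hS.isOrthogonalOutside_of_isDivDensity hφ hψ hψ2 hdiv)
  refine hL.ae_eq ?_
  filter_upwards [hae, hdiv.ae_mul_eq hψ2 hψ.1.continuous] with u h1 h2
  rw [← h1, h2]

theorem IsSpectralMeasure.isOrthogonalOutside_iff (hS : IsSpectralMeasure M S) (hA : IsCompact A)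
    (hφ : MemLp φ 2 S) : IsOrthogonalOutside S A φ ↔
      ∃ ψ ∈ expTypeClass A, SqIntegrableInv (spectralDensity S) ψ ∧
        IsDivDensity S φ fun u => conj (ψ u) := by
  have := hS.locallyFinite
  refine ⟨fun h => ?_, fun ⟨ψ, hψ, hψ2, hdiv⟩ =>
    hS.isOrthogonalOutside_of_isDivDensity hφ hψ hψ2 hdiv⟩
  obtain ⟨ψ, hψ, -, hac, hsing⟩ := hS.exists_mem_expTypeClass hA hφ h
  exact ⟨ψ, hψ, sqIntegrableInv_of_ae hφ hac, isDivDensity_of_ae hac hsing⟩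

end Representation

/-! ### Plancherel pairing with non-smooth functions -/

section Plancherel

variable {d : ℕ}

theorem IsBddCompact.memLp {f : EuclideanSpace ℝ (Fin d) → ℂ} (hf : IsBddCompact f)
    (p : ENNReal) : MemLp f p volume := by
  obtain ⟨hm, ⟨C, hC⟩, hs⟩ := hf
  refine (memLp_indicator_const p hs.isCompact.measurableSet C
    (Or.inr hs.isCompact.measure_lt_top.ne)).mono hm.aestronglyMeasurable
    (Filter.Eventually.of_forall fun x => ?_)
  by_cases hx : x ∈ tsupport f
  · rw [Set.indicator_of_mem hx]
    exact (hC x).trans (le_abs_self _)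
  · simp [image_eq_zero_of_notMem_tsupport hx]

theorem integral_mul_eq_inner {α : Type*} [MeasurableSpace α] {μ : Measure α}
    (a b : Lp ℂ 2 μ) : ∫ x, a x * b x ∂μ = inner ℂ ((Lp.memLp a).star.toLp _) b := by
  rw [L2.inner_def]
  refine integral_congr_ae ?_
  filter_upwards [(Lp.memLp a).star.coeFn_toLp] with x hx
  rw [hx]
  simp [mul_comm]

theorem continuous_integral_mul {α : Type*} [MeasurableSpace α] {μ : Measure α} (a : Lp ℂ 2 μ) :
    Continuous fun b : Lp ℂ 2 μ => ∫ x, a x * b x ∂μ := by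
  simp_rw [integral_mul_eq_inner]
  fun_prop

theorem integral_schwartz_mul_fourier (f : SchwartzMap (EuclideanSpace ℝ (Fin d)) ℂ)
    (b : Lp ℂ 2 (volume : Measure (EuclideanSpace ℝ (Fin d)))) :
    ∫ x, f x * (FourierTransform.fourier b : Lp ℂ 2 volume) x =
      ∫ x, (FourierTransform.fourier f : SchwartzMap _ ℂ) x * b x := by
  have h := congrArg (fun T => T f) (Lp.fourier_toTemperedDistribution_eq b)
  simp only [TemperedDistribution.fourier_apply, Lp.toTemperedDistribution_apply,
    smul_eq_mul] at h
  exact h.symm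

/-- Both sides are continuous in `a`, and for Schwartz `a` the identity is the definition of the
distributional Fourier transform. -/
theorem integral_mul_fourier_Lp
    (a b : Lp ℂ 2 (volume : Measure (EuclideanSpace ℝ (Fin d)))) :
    ∫ x, a x * (FourierTransform.fourier b : Lp ℂ 2 volume) x =
      ∫ x, (FourierTransform.fourier a : Lp ℂ 2 volume) x * b x := by
  refine DenseRange.induction_on (p := fun a : Lp ℂ 2 volume =>
      ∫ x, a x * (FourierTransform.fourier b : Lp ℂ 2 volume) x =
        ∫ x, (FourierTransform.fourier a : Lp ℂ 2 volume) x * b x)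
    (SchwartzMap.denseRange_toLpCLM (p := 2) (μ := volume) ENNReal.ofNat_ne_top) a ?_ fun f => ?_
  · simp_rw [mul_comm _ ((FourierTransform.fourier b : Lp ℂ 2 volume) _), mul_comm _ (b _)]
    exact isClosed_eq (continuous_integral_mul _)
      ((continuous_integral_mul b).comp (Lp.fourierTransformₗᵢ _ ℂ).continuous)
  · simp only [SchwartzMap.toLpCLM_apply, SchwartzMap.toLp_fourier_eq]
    refine ((integral_congr_ae ?_).trans (integral_schwartz_mul_fourier f b)).trans
      (integral_congr_ae ?_)
    · filter_upwards [f.coeFn_toLp 2 volume] with x hx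
      rw [hx]
    · filter_upwards [(FourierTransform.fourier f : SchwartzMap _ ℂ).coeFn_toLp 2 volume] with x hx
      rw [hx]

theorem fourier_toLp_ae_eq {f : EuclideanSpace ℝ (Fin d) → ℂ} (hf : Integrable f)
    (hf2 : MemLp f 2 volume) :
    (FourierTransform.fourier (hf2.toLp f) : Lp ℂ 2 volume) =ᵐ[volume]
      FourierTransform.fourier f := by
  refine ae_eq_of_integral_contDiff_smul_eq ((Lp.memLp _).locallyIntegrable (by norm_num))
    (Continuous.locallyIntegrable ?_) fun g hg hgs => ?_
  · exact VectorFourier.fourierIntegral_continuous Real.continuous_fourierChar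
      (by exact continuous_inner) hf
  · have hgc : ContDiff ℝ ((⊤ : ℕ∞) : WithTop ℕ∞) fun x => (g x : ℂ) :=
      Complex.ofRealCLM.contDiff.comp hg
    have hgcs : HasCompactSupport fun x => (g x : ℂ) := hgs.comp_left Complex.ofReal_zero
    have h := integral_schwartz_mul_fourier (hgcs.toSchwartzMap hgc) (hf2.toLp f)
    have h2 : ∫ x, FourierTransform.fourier (fun x => (g x : ℂ)) x * f x =
        ∫ x, (g x : ℂ) * FourierTransform.fourier f x := by
      simpa using! (VectorFourier.integral_fourierIntegral_smul_eq_flip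
        (L := innerₗ (EuclideanSpace ℝ (Fin d))) Real.continuous_fourierChar continuous_inner
        (hgc.continuous.integrable_of_hasCompactSupport hgcs) hf)
    simp only [Complex.real_smul]
    refine h.trans ((integral_congr_ae ?_).trans h2)
    filter_upwards [hf2.coeFn_toLp] with x hx
    rw [hx, SchwartzMap.fourier_coe]
    rfl

theorem fourierHat_eq_fourier_comp_smul (f : EuclideanSpace ℝ (Fin d) → ℂ)
    (u : EuclideanSpace ℝ (Fin d)) :
    fourierHat f u = ((2 * Real.pi) ^ d : ℝ) *
      FourierTransform.fourier (fun x => f ((2 * Real.pi) • x)) u := by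
  have h := Measure.integral_comp_smul (volume : Measure (EuclideanSpace ℝ (Fin d)))
    (fun t => Complex.exp (-(Complex.I * ((inner ℝ u t : ℝ) : ℂ))) * f t) (2 * Real.pi)
  rw [← fourierHat_def, finrank_euclideanSpace, Fintype.card_fin, abs_of_pos (by positivity),
    Complex.real_smul] at h
  have h2 : FourierTransform.fourier (fun x => f ((2 * Real.pi) • x)) u =
      ∫ x, Complex.exp (-(Complex.I * ((inner ℝ u ((2 * Real.pi) • x) : ℝ) : ℂ))) *
        f ((2 * Real.pi) • x) := by
    rw [Real.fourier_eq']
    congr 1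
    ext x
    rw [smul_eq_mul, inner_smul_right, real_inner_comm]
    congr 2
    push_cast
    ring
  rw [h2, h, ← mul_assoc, ← Complex.ofReal_mul, mul_inv_cancel₀ (by positivity),
    Complex.ofReal_one, one_mul]

/-- The pairing must hold for all bounded compactly supported `f`, not only smooth ones, because it
will be applied to the discontinuous function `conj (1_A γ)`. -/
theorem exists_fourier_of_memLp {ψ : EuclideanSpace ℝ (Fin d) → ℂ} (hψ : MemLp ψ 2 volume) :
    ∃ g : EuclideanSpace ℝ (Fin d) → ℂ, MemLp g 2 volume ∧
      ∀ f : EuclideanSpace ℝ (Fin d) → ℂ, IsBddCompact f →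
        ∫ t, f t * g t = ∫ u, fourierHat f u * ψ u := by
  have hpi : (2 * Real.pi) ≠ 0 := by positivity
  set G : Lp ℂ 2 (volume : Measure (EuclideanSpace ℝ (Fin d))) :=
    FourierTransform.fourier (hψ.toLp ψ)
  -- The dilation passes from the kernel `e^{-2πi⟨u,t⟩}` to `e^{-i⟨u,t⟩}`.
  refine ⟨fun t => G ((2 * Real.pi)⁻¹ • t), ?_, fun f hf => ?_⟩
  · have hmap := Measure.map_addHaar_smul (volume : Measure (EuclideanSpace ℝ (Fin d)))
      (inv_ne_zero hpi)
    have h1 : MemLp G 2 (Measure.map (fun t => (2 * Real.pi)⁻¹ • t)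
        (volume : Measure (EuclideanSpace ℝ (Fin d)))) := by
      rw [hmap]
      exact (Lp.memLp G).smul_measure ENNReal.ofReal_ne_top
    exact h1.comp_of_map (by fun_prop)
  · set fs : EuclideanSpace ℝ (Fin d) → ℂ := fun x => f ((2 * Real.pi) • x)
    have hfs : IsBddCompact fs := by
      obtain ⟨hm, ⟨C, hC⟩, hs⟩ := hf
      exact ⟨hm.comp (by fun_prop), ⟨C, fun x => hC _⟩, hs.comp_smul hpi⟩
    have h1 := integral_mul_fourier_Lp ((hfs.memLp 2).toLp fs) (hψ.toLp ψ)
    have h2 : ∫ x, fs x * G x = ∫ u, FourierTransform.fourier fs u * ψ u := by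
      refine ((integral_congr_ae ?_).trans h1).trans (integral_congr_ae ?_)
      · filter_upwards [(hfs.memLp 2).coeFn_toLp] with x hx
        rw [hx]
      · filter_upwards [fourier_toLp_ae_eq hfs.integrable (hfs.memLp 2), hψ.coeFn_toLp]
          with x hx hx'
        rw [hx, hx']
    have h3 := Measure.integral_comp_smul (volume : Measure (EuclideanSpace ℝ (Fin d)))
      (fun t => f t * G ((2 * Real.pi)⁻¹ • t)) (2 * Real.pi)
    simp only [smul_smul, inv_mul_cancel₀ hpi, one_smul] at h3
    rw [finrank_euclideanSpace, Fintype.card_fin, abs_of_pos (by positivity),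
      Complex.real_smul] at h3
    simp_rw [fourierHat_eq_fourier_comp_smul, mul_assoc]
    rw [integral_const_mul, ← h2, h3, ← mul_assoc, ← Complex.ofReal_mul,
      mul_inv_cancel₀ (by positivity), Complex.ofReal_one, one_mul]

theorem IsL2Fourier.ae_eq {ψ g g' : EuclideanSpace ℝ (Fin d) → ℂ} (h : IsL2Fourier ψ g)
    (h' : IsL2Fourier ψ g') : g =ᵐ[volume] g' := by
  refine ae_eq_of_integral_contDiff_smul_eq (h.1.locallyIntegrable (by norm_num))
    (h'.1.locallyIntegrable (by norm_num)) fun f hf hfs => ?_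
  have hmem : (fun x => (f x : ℂ)) ∈ testFunctions (Set.univ : Set (EuclideanSpace ℝ (Fin d))) :=
    ⟨Complex.ofRealCLM.contDiff.comp hf, hfs.comp_left Complex.ofReal_zero, Set.subset_univ _⟩
  simp only [Complex.real_smul]
  rw [h.2 _ hmem, h'.2 _ hmem]

theorem IsL2Fourier.integral_mul_eq {ψ g : EuclideanSpace ℝ (Fin d) → ℂ}
    (hψ : MemLp ψ 2 volume) (h : IsL2Fourier ψ g) {f : EuclideanSpace ℝ (Fin d) → ℂ}
    (hf : IsBddCompact f) : ∫ t, f t * g t = ∫ u, fourierHat f u * ψ u := by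
  obtain ⟨g', hg', hint⟩ := exists_fourier_of_memLp hψ
  have hae := h.ae_eq ⟨hg', fun f hf => hint f (IsBddCompact.of_test hf)⟩
  rw [← hint f hf]
  refine integral_congr_ae ?_
  filter_upwards [hae] with t ht
  rw [ht]

end Plancherel

/-! ### Rigidity as membership in a closed subspace -/

section Rigidity

variable {Ω : Type*} [MeasurableSpace Ω] {P : Measure Ω} {d : ℕ}
  {M : StatRandomMeasure P d} {S : Measure (EuclideanSpace ℝ (Fin d))}
  {A : Set (EuclideanSpace ℝ (Fin d))}

theorem lintegral_enorm_sq_fourierHat_conj (hS : S.map (fun u => -u) = S)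
    (f : EuclideanSpace ℝ (Fin d) → ℂ) :
    ∫⁻ u, ‖fourierHat (fun t => conj (f t)) u‖ₑ ^ 2 ∂S = ∫⁻ u, ‖fourierHat f u‖ₑ ^ 2 ∂S := by
  simp_rw [fourierHat_conj, RCLike.enorm_conj]
  exact lintegral_neg_of_even hS fun u => ‖fourierHat f u‖ₑ ^ 2

theorem conj_mem_testFunctions {U : Set (EuclideanSpace ℝ (Fin d))}
    {h : EuclideanSpace ℝ (Fin d) → ℂ} (hh : h ∈ testFunctions U) :
    (fun t => conj (h t)) ∈ testFunctions U := by
  refine ⟨Complex.conjCLE.contDiff.comp hh.1, hh.2.1.comp_left (map_zero _), ?_⟩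
  refine (closure_mono fun t ht => ?_ : tsupport (fun t => conj (h t)) ⊆ tsupport h).trans hh.2.2
  intro h0
  exact ht (by simp [h0])

/-- The transforms of the test functions supported in `U`, as a subspace of `L²(S)`. -/
def IsSpectralMeasure.testSubmodule (hS : IsSpectralMeasure M S)
    (U : Set (EuclideanSpace ℝ (Fin d))) : Submodule ℂ (Lp ℂ 2 S) where
  carrier := {x | ∃ h, ∃ hh : h ∈ testFunctions U,
    x = (hS.memLp_fourierHat (IsBddCompact.of_test hh)).toLp _}
  zero_mem' := by
    have h0 : (fun _ => (0 : ℂ)) ∈ testFunctions U := by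
      refine ⟨contDiff_const, HasCompactSupport.zero, ?_⟩
      simp [tsupport, Function.support]
    refine ⟨_, h0, ?_⟩
    refine Lp.ext ?_
    filter_upwards [Lp.coeFn_zero ℂ 2 S,
      (hS.memLp_fourierHat (IsBddCompact.of_test h0)).coeFn_toLp] with u h1 h2
    rw [h1, h2]
    simp [fourierHat]
  add_mem' := by
    rintro _ _ ⟨h, hh, rfl⟩ ⟨g, hg, rfl⟩
    have hs : (fun t => h t + g t) ∈ testFunctions U := by
      refine ⟨hh.1.add hg.1, hh.2.1.add hg.2.1, ?_⟩
      exact (tsupport_add h g).trans (Set.union_subset hh.2.2 hg.2.2)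
    refine ⟨_, hs, ?_⟩
    rw [← MemLp.toLp_add]
    congr 1
    ext u
    exact (fourierHat_add (IsBddCompact.of_test hh).integrable
      (IsBddCompact.of_test hg).integrable u).symm
  smul_mem' := by
    rintro c _ ⟨h, hh, rfl⟩
    have hs : (fun t => c * h t) ∈ testFunctions U := by
      refine ⟨contDiff_const.mul hh.1, hh.2.1.mul_left, ?_⟩
      exact (closure_mono (Function.support_mul_subset_right _ _)).trans hh.2.2
    refine ⟨_, hs, ?_⟩
    rw [← MemLp.toLp_const_smul]
    congr 1
    ext u
    exact (fourierHat_const_mul c h u).symm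

theorem edist_toLp_sq {f g : EuclideanSpace ℝ (Fin d) → ℂ} (hf : MemLp f 2 S)
    (hg : MemLp g 2 S) :
    edist (hf.toLp f) (hg.toLp g) ^ 2 = ∫⁻ u, ‖f u - g u‖ₑ ^ 2 ∂S := by
  rw [Lp.edist_toLp_toLp, eLpNorm_eq_lintegral_rpow_enorm_toReal (by simp) (by simp)]
  simp only [ENNReal.toReal_ofNat, ENNReal.rpow_ofNat]
  rw [← ENNReal.rpow_ofNat, ← ENNReal.rpow_mul]
  norm_num

/-- The variance is a squared `L²(S)` distance. Evenness of `S` allows `γ` and `h` to be conjugated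
together without changing it, and conjugation preserves the test functions; this puts `conj γ` in
place for the final pairing with `ψ̂`. -/
theorem IsSpectralMeasure.linearlyRigid_iff_mem_closure [IsProbabilityMeasure P]
    (hS : IsSpectralMeasure M S) (hA : MeasurableSet A) {γ : EuclideanSpace ℝ (Fin d) → ℂ}
    (hγ : IsBddCompact γ) :
    LinearlyRigid M γ A ↔ (hS.memLp_fourierHat (hγ.indicator hA).conj).toLp _ ∈
      closure (hS.testSubmodule Aᶜ : Set (Lp ℂ 2 S)) := by
  have hγA := hγ.indicator hA
  have h0 : (fun _ => (0 : ℂ)) ∈ testFunctions Aᶜ := by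
    refine ⟨contDiff_const, HasCompactSupport.zero, ?_⟩
    simp [tsupport, Function.support]
  have : Nonempty (testFunctions Aᶜ) := ⟨⟨_, h0⟩⟩
  have hkey : ∀ {h : EuclideanSpace ℝ (Fin d) → ℂ} (hh : h ∈ testFunctions Aᶜ),
      edist ((hS.memLp_fourierHat hγA.conj).toLp _)
        ((hS.memLp_fourierHat (IsBddCompact.of_test (conj_mem_testFunctions hh))).toLp _) ^ 2 =
      ENNReal.ofReal (complexVariance P
        (fun ω => M.cintegral (A.indicator γ) ω - M.cintegral h ω)) := by
    intro h hh
    have hb := IsBddCompact.of_test hh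
    rw [edist_toLp_sq, hS.complexVariance_sub hγA hb]
    simp_rw [← fourierHat_sub hγA.conj.integrable hb.conj.integrable,
      ← fourierHat_sub hγA.integrable hb.integrable, ← map_sub]
    exact lintegral_enorm_sq_fourierHat_conj hS.even fun t => A.indicator γ t - h t
  have hbdd : BddBelow (Set.range fun h : testFunctions Aᶜ => complexVariance P
      (fun ω => M.cintegral (A.indicator γ) ω - M.cintegral h.1 ω)) :=
    ⟨0, by rintro _ ⟨h, rfl⟩; exact complexVariance_nonneg _⟩
  unfold LinearlyRigid
  rw [EMetric.mem_closure_iff]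
  constructor
  · intro hinf ε hε
    -- The radius `ε` may be infinite, in which case any positive `δ` serves.
    obtain ⟨δ, hδ0, hδ⟩ : ∃ δ : ℝ, 0 < δ ∧ ENNReal.ofReal δ ≤ ε ^ 2 := by
      rcases eq_or_ne ε ⊤ with rfl | hε'
      · exact ⟨1, one_pos, by simp⟩
      · exact ⟨(ε ^ 2).toReal, ENNReal.toReal_pos (pow_ne_zero _ hε.ne')
          (ENNReal.pow_ne_top hε'), ENNReal.ofReal_toReal_le⟩
    obtain ⟨h, hh⟩ := exists_lt_of_ciInf_lt (hinf.trans_lt hδ0)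
    refine ⟨_, ⟨_, conj_mem_testFunctions h.2, rfl⟩, ?_⟩
    refine lt_of_not_ge fun hle => (pow_le_pow_left' hle 2).not_gt ?_
    rw [hkey h.2]
    exact (ENNReal.ofReal_lt_ofReal_iff hδ0).2 hh |>.trans_le hδ
  · intro hcl
    refine le_antisymm (le_of_forall_pos_lt_add fun ε hε => ?_)
      (le_ciInf fun h => complexVariance_nonneg _)
    obtain ⟨_, ⟨h, hh, rfl⟩, hlt⟩ := hcl (ENNReal.ofReal √ε)
      (ENNReal.ofReal_pos.2 (Real.sqrt_pos.2 hε))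
    have hh' := conj_mem_testFunctions hh
    refine (ciInf_le hbdd ⟨_, hh'⟩).trans_lt ?_
    have h1 := hkey hh'
    simp only [Complex.conj_conj] at h1
    rw [zero_add, ← ENNReal.ofReal_lt_ofReal_iff hε, ← h1, ← Real.sq_sqrt hε.le,
      ENNReal.ofReal_pow (Real.sqrt_nonneg _)]
    exact ENNReal.pow_lt_pow_left two_ne_zero hlt

theorem IsSpectralMeasure.mem_orthogonal_testSubmodule_iff (hS : IsSpectralMeasure M S)
    (x : Lp ℂ 2 S) : x ∈ (hS.testSubmodule Aᶜ)ᗮ ↔ IsOrthogonalOutside S A x := by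
  rw [Submodule.mem_orthogonal']
  have hinner : ∀ (h) (hh : h ∈ testFunctions Aᶜ),
      inner ℂ x ((hS.memLp_fourierHat (IsBddCompact.of_test hh)).toLp _) =
        ∫ u, conj (x u) * fourierHat h u ∂S := by
    intro h hh
    rw [L2.inner_def]
    refine integral_congr_ae ?_
    filter_upwards [(hS.memLp_fourierHat (IsBddCompact.of_test hh)).coeFn_toLp] with u hu
    rw [hu]
    simp [mul_comm]
  constructor
  · intro hx h hh
    rw [← hinner h hh]
    exact hx _ ⟨h, hh, rfl⟩
  · rintro hx _ ⟨h, hh, rfl⟩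
    rw [hinner h hh]
    exact hx h hh

/-- In a Hilbert space the closure of a subspace is its double orthogonal complement. -/
theorem IsSpectralMeasure.mem_closure_testSubmodule_iff (hS : IsSpectralMeasure M S)
    {f : EuclideanSpace ℝ (Fin d) → ℂ} (hf : MemLp f 2 S) :
    hf.toLp f ∈ closure (hS.testSubmodule Aᶜ : Set (Lp ℂ 2 S)) ↔
      ∀ φ, MemLp φ 2 S → IsOrthogonalOutside S A φ → ∫ u, conj (φ u) * f u ∂S = 0 := by
  rw [← Submodule.topologicalClosure_coe, SetLike.mem_coe,
    ← Submodule.orthogonal_orthogonal_eq_closure, Submodule.mem_orthogonal]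
  have hinner : ∀ {φ : EuclideanSpace ℝ (Fin d) → ℂ} (hφ : MemLp φ 2 S),
      inner ℂ (hφ.toLp φ) (hf.toLp f) = ∫ u, conj (φ u) * f u ∂S := by
    intro φ hφ
    rw [L2.inner_def]
    refine integral_congr_ae ?_
    filter_upwards [hf.coeFn_toLp, hφ.coeFn_toLp] with u hu hu'
    rw [hu, hu']
    simp [mul_comm]
  constructor
  · intro h φ hφ hφA
    rw [← hinner hφ]
    refine h _ ((hS.mem_orthogonal_testSubmodule_iff _).2 fun g hg => ?_)
    rw [← hφA g hg]
    refine integral_congr_ae ?_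
    filter_upwards [hφ.coeFn_toLp] with u hu
    rw [hu]
  · intro h x hx
    have := hinner (Lp.memLp x)
    rw [Lp.toLp_coeFn] at this
    rw [this]
    exact h x (Lp.memLp x) ((hS.mem_orthogonal_testSubmodule_iff x).1 hx)

theorem IsSpectralMeasure.linearlyRigid_iff [IsProbabilityMeasure P]
    (hS : IsSpectralMeasure M S) (hA : IsCompact A) {γ : EuclideanSpace ℝ (Fin d) → ℂ}
    (hγ : IsBddCompact γ) :
    LinearlyRigid M γ A ↔ ∀ ψ ∈ expTypeClass A, SqIntegrableInv (spectralDensity S) ψ →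
      ∀ g, IsL2Fourier ψ g → ∫ t in A, conj (γ t) * g t = 0 := by
  have := hS.locallyFinite
  have hγA := (hγ.indicator hA.measurableSet).conj
  have hγL := hS.memLp_fourierHat hγA
  have hset : ∀ g : EuclideanSpace ℝ (Fin d) → ℂ, ∫ t in A, conj (γ t) * g t =
      ∫ t, conj (A.indicator γ t) * g t := by
    intro g
    rw [← integral_indicator hA.measurableSet]
    congr 1
    ext t
    by_cases ht : t ∈ A <;> simp [ht]
  -- Pairing with `φ = conj ψ / s` in `L²(S)` becomes pairing with `ψ` in Lebesgue measure, and
  -- Plancherel moves it to `ψ̂ = g` on the space side.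
  have hpair : ∀ {ψ φ g : EuclideanSpace ℝ (Fin d) → ℂ}, ψ ∈ expTypeClass A →
      SqIntegrableInv (spectralDensity S) ψ → MemLp φ 2 S →
      IsDivDensity S φ (fun u => conj (ψ u)) → IsL2Fourier ψ g →
      ∫ u, conj (φ u) * fourierHat (fun t => conj (A.indicator γ t)) u ∂S =
        ∫ t in A, conj (γ t) * g t := by
    intro ψ φ g hψ hψ2 hφ hdiv hg
    have hconj : MemLp (fun u => conj (φ u)) 2 S := hφ.star
    rw [hset, integral_mul_conj_eq (hdiv.ae_mul_eq hψ2 hψ.1.continuous) hdiv.2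
      (hconj.integrable_mul hγL), hg.integral_mul_eq (hS.memLp_of_sqIntegrableInv hA hψ hψ2) hγA]
  rw [hS.linearlyRigid_iff_mem_closure hA.measurableSet hγ, hS.mem_closure_testSubmodule_iff hγL]
  constructor
  · intro h ψ hψ hψ2 g hg
    obtain ⟨φ, hφ, hdiv⟩ := exists_isDivDensity hψ.1.continuous hψ2
    rw [← hpair hψ hψ2 hφ hdiv hg]
    exact h φ hφ ((hS.isOrthogonalOutside_iff hA hφ).2 ⟨ψ, hψ, hψ2, hdiv⟩)
  · intro h φ hφ hφA
    obtain ⟨ψ, hψ, hψ2, hdiv⟩ := (hS.isOrthogonalOutside_iff hA hφ).1 hφA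
    obtain ⟨g, hg2, hg⟩ := exists_fourier_of_memLp (hS.memLp_of_sqIntegrableInv hA hψ hψ2)
    have hgF : IsL2Fourier ψ g := ⟨hg2, fun f hf => hg f (IsBddCompact.of_test hf)⟩
    rw [hpair hψ hψ2 hφ hdiv hgF]
    exact h ψ hψ hψ2 g hgF

end Rigidity

end

theorem theorem5p3 {Ω : Type*} [MeasurableSpace Ω] (P : Measure Ω) [IsProbabilityMeasure P]
    (d : ℕ) (M : StatRandomMeasure P d) (S : Measure (EuclideanSpace ℝ (Fin d)))
    (hS : IsSpectralMeasure M S)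
    (A : Set (EuclideanSpace ℝ (Fin d))) (hAcompact : IsCompact A) (hAconvex : Convex ℝ A)
    (hAint : (interior A).Nonempty) :
    (∀ ψ ∈ expTypeClass A, SqIntegrableInv (spectralDensity S) ψ → ∃ g, IsL2Fourier ψ g) ∧
    (∀ γ : EuclideanSpace ℝ (Fin d) → ℂ, IsBddCompact γ →
      (LinearlyRigid M γ A ↔
        ∀ ψ ∈ expTypeClass A, SqIntegrableInv (spectralDensity S) ψ →
          ∀ g, IsL2Fourier ψ g → ∫ t in A, conj (γ t) * g t = 0)) ∧
    (∀ φ : EuclideanSpace ℝ (Fin d) → ℂ, MemLp φ 2 S →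
      (IsOrthogonalOutside S A φ ↔
        ∃ ψ ∈ expTypeClass A, SqIntegrableInv (spectralDensity S) ψ ∧
          IsDivDensity S φ (fun u => conj (ψ u)))) := by
  refine ⟨fun ψ hψ hψ2 => ?_, fun γ hγ => hS.linearlyRigid_iff hAcompact hγ,
    fun φ hφ => hS.isOrthogonalOutside_iff hAcompact hφ⟩
  obtain ⟨g, hg2, hg⟩ := exists_fourier_of_memLp (hS.memLp_of_sqIntegrableInv hAcompact hψ hψ2)
  exact ⟨g, hg2, fun f hf => hg f (IsBddCompact.of_test hf)⟩
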